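/- Let $n\ge 1$. Call $f:\mathbb R^n\to[0,\infty)$ log-concave if $f(\lambda x+(1-\lambda)y)\ge f(x)^{\lambda}f(y)^{1-\lambda}$ for all $x,y\in\mathbb R^n$ and $0<\lambda<1$. Let $f$ be a non-negative, Lebesgue integrable, log-concave function on $\mathbb R^n$ with $\int_{\mathbb R^n} f(x)\,dx>0$ and with center of mass at the origin, i.e. $\int_{\mathbb R^n} x f(x)\,dx=0$. Then for every unit vector $\theta\in\mathbb R^n$ the function $s\mapsto f(s\theta)$ is integrable on $\mathbb R$ and $$\int_0^\infty f(s\theta)\,ds\ \ge\ e^{-n}\int_{-\infty}^\infty f(s\theta)\,ds .$$ The constant $e^{-n}$ is the best possible: it is the largest real number $a$ such that $\int_0^\infty f(s\theta)\,ds\ge a\int_{-\infty}^\infty f(s\theta)\,ds$ for all such $f$ and all unit vectors $\theta$. Moreover, let $$C=\{x\in\mathbb R^n:\ x_1\ge -n,\ x_2^2+\dots+x_n^2\le (x_1+n)^2\}$$ be the infinite circular cone with vertex $(-n,0,\dots,0)$ and axis along $e_1=(1,0,\dots,0)$. Then $f(x)=\mathbf 1_C(x)e^{-x_1}$ is a function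 of the above kind, $\int_{\mathbb R^n} x f(x)\,dx$ converges absolutely, and for $\theta=e_1$ equality holds: $\int_0^\infty f(se_1)\,ds=1$ and $\int_{-\infty}^\infty f(se_1)\,ds=e^n$. -/

import Mathlib

open MeasureTheory

/-- `f : E → ℝ` is log-concave: it is non-negative and
`f (a x + b y) ≥ f(x)^a f(y)^b` for all `x, y` and all `a, b ≥ 0` with `a + b = 1`.
The value `0` is allowed, so indicators of convex sets are log-concave.
(For `a = 0` or `b = 0` the convention `0 ^ 0 = 1` of real powers makes the inequality trivial.) -/
structure LogConcave {E : Type*} [AddCommGroup E] [Module ℝ E] (f : E → ℝ) : Prop where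
  nonneg : ∀ x, 0 ≤ f x
  rpow_mul_rpow_le : ∀ x y : E, ∀ a b : ℝ, 0 ≤ a → 0 ≤ b → a + b = 1 →
    f x ^ a * f y ^ b ≤ f (a • x + b • y)

/-- `f` is an integrable (non-negative) log-concave function on `ℝⁿ` of positive total mass whose
center of mass is the origin. -/
structure CenteredLogConcave {n : ℕ} (f : EuclideanSpace ℝ (Fin n) → ℝ) : Prop where
  logConcave : LogConcave f
  integrable : Integrable f
  mass_pos : 0 < ∫ x, f x
  center : ∫ x, f x • x = 0

/-- The infinite circular cone `{x : x₁ ≥ -n, x₂² + ⋯ + xₙ² ≤ (x₁ + n)²}` in `ℝⁿ`, with vertex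
`(-n, 0, …, 0)` and axis along `e₁`. The first coordinate has index `0`. -/
def grunbaumCone (n : ℕ) [NeZero n] : Set (EuclideanSpace ℝ (Fin n)) :=
  {x | -(n : ℝ) ≤ x 0 ∧ ∑ i ∈ Finset.univ.erase 0, x i ^ 2 ≤ (x 0 + n) ^ 2}

/-- The function `1_C(x) e^{-x₁}`, where `C` is the cone above. -/
noncomputable def coneExp (n : ℕ) [NeZero n] : EuclideanSpace ℝ (Fin n) → ℝ :=
  (grunbaumCone n).indicator fun x => Real.exp (-(x 0))

open Set Filter Topology

/-! Write points as `(t, y)` in `ℝ × V`, with `t` along `θ` and `V = θᗮ` of dimension `n - 1`. Let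
`F (t, y)` be the integral of `f (·, y)` over `(t, ∞)`, `G y` the integral over the whole line, and
`I` the total mass. By Prékopa–Leindler both `F` and `G` are log-concave. Since `f` has its center
of mass at the origin, Jensen's inequality for the concave function `log F` gives `I log F(0) ≥ ∫ f
log F`.

The right side is bounded below by splitting `log F = log G(0) - log (G(0) / G) - log (G / F)`.
Integrating out `t`, the second term becomes the entropy `∫ G log (G(0) / G)`. Comparing `G` with
its dilates shows that this is at most `(n - 1) I` (`LogConcave.integral_mul_log_le`). On each
fibre, `F / G` dominates a uniform variable under the density `f / G`, and `-log` of a uniform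
variable has mean `1`, so the third term costs at most `I` (`integrable_mul_log_tail`). Hence `log
F(0) ≥ log G(0) - n`.

For `e^{-x₁}` on a cone with vertex at the origin, the dilation comparison holds for ratios on both
sides of `1`, which determines its first moment exactly. The shift by `n` then centers it. -/

namespace LogConcave

/-! ### Elementary consequences of log-concavity -/

section Algebra

variable {E F : Type*} [AddCommGroup E] [Module ℝ E] [AddCommGroup F] [Module ℝ F]

theorem mk_of_pos {f : E → ℝ} (h0 : ∀ x, 0 ≤ f x)
    (h : ∀ x y : E, 0 < f x → 0 < f y → ∀ a b : ℝ, 0 < a → 0 < b → a + b = 1 →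
      f x ^ a * f y ^ b ≤ f (a • x + b • y)) : LogConcave f := by
  refine ⟨h0, fun x y a b ha hb hab => ?_⟩
  rcases ha.eq_or_lt with rfl | ha
  · simp only [zero_add] at hab
    simp [hab]
  rcases hb.eq_or_lt with rfl | hb
  · simp only [add_zero] at hab
    simp [hab]
  rcases (h0 x).eq_or_lt with hx | hx
  · simpa [← hx, Real.zero_rpow ha.ne'] using h0 _
  rcases (h0 y).eq_or_lt with hy | hy
  · simpa [← hy, Real.zero_rpow hb.ne'] using h0 _
  exact h x y hx hy a b ha hb hab

theorem pos_combo {f : E → ℝ} (hf : LogConcave f) {x y : E} (hx : 0 < f x) (hy : 0 < f y)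
    {a b : ℝ} (ha : 0 ≤ a) (hb : 0 ≤ b) (hab : a + b = 1) : 0 < f (a • x + b • y) :=
  (mul_pos (Real.rpow_pos_of_pos hx a) (Real.rpow_pos_of_pos hy b)).trans_le
    (hf.rpow_mul_rpow_le x y a b ha hb hab)

theorem log_combo {f : E → ℝ} (hf : LogConcave f) {x y : E} (hx : 0 < f x) (hy : 0 < f y)
    {a b : ℝ} (ha : 0 ≤ a) (hb : 0 ≤ b) (hab : a + b = 1) :
    a * Real.log (f x) + b * Real.log (f y) ≤ Real.log (f (a • x + b • y)) := by
  rw [← Real.log_rpow hx, ← Real.log_rpow hy,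
    ← Real.log_mul (Real.rpow_pos_of_pos hx a).ne' (Real.rpow_pos_of_pos hy b).ne']
  exact Real.log_le_log (mul_pos (Real.rpow_pos_of_pos hx a) (Real.rpow_pos_of_pos hy b))
    (hf.rpow_mul_rpow_le x y a b ha hb hab)

theorem min_le {f : E → ℝ} (hf : LogConcave f) (x y : E) {a b : ℝ} (ha : 0 ≤ a) (hb : 0 ≤ b)
    (hab : a + b = 1) : min (f x) (f y) ≤ f (a • x + b • y) := by
  have hm : 0 ≤ min (f x) (f y) := le_min (hf.nonneg x) (hf.nonneg y)
  calc min (f x) (f y) = min (f x) (f y) ^ a * min (f x) (f y) ^ b := by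
        rw [← Real.rpow_add_of_nonneg hm ha hb, hab, Real.rpow_one]
    _ ≤ f x ^ a * f y ^ b := by
        have h1 := min_le_left (f x) (f y)
        have h2 := min_le_right (f x) (f y)
        exact mul_le_mul (Real.rpow_le_rpow hm h1 ha) (Real.rpow_le_rpow hm h2 hb)
          (Real.rpow_nonneg hm b) (Real.rpow_nonneg (hf.nonneg x) a)
    _ ≤ _ := hf.rpow_mul_rpow_le x y a b ha hb hab

theorem convex_lt {f : E → ℝ} (hf : LogConcave f) (r : ℝ) : Convex ℝ {x | r < f x} :=
  fun x hx y hy _ _ ha hb hab => (lt_min hx hy).trans_le (hf.min_le x y ha hb hab)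

theorem comp_affine {f : E → ℝ} (hf : LogConcave f) (L : F →ₗ[ℝ] E) (c : E) :
    LogConcave fun x => f (L x + c) := by
  refine ⟨fun x => hf.nonneg _, fun x y a b ha hb hab => ?_⟩
  convert! hf.rpow_mul_rpow_le (L x + c) (L y + c) a b ha hb hab using 2
  have : c = a • c + b • c := by rw [← add_smul, hab, one_smul]
  rw [map_add, map_smul, map_smul, smul_add, smul_add]
  nth_rw 1 [this]
  abel

theorem indicator {f : E → ℝ} (hf : LogConcave f) {s : Set E} (hs : Convex ℝ s) :
    LogConcave (s.indicator f) := by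
  refine mk_of_pos (fun x => indicator_nonneg (fun x _ => hf.nonneg x) x) ?_
  intro x y hx hy a b ha hb hab
  have hxs : x ∈ s := by
    by_contra h
    simp [h] at hx
  have hys : y ∈ s := by
    by_contra h
    simp [h] at hy
  rw [indicator_of_mem hxs, indicator_of_mem hys, indicator_of_mem (hs hxs hys ha.le hb.le hab)]
  exact hf.rpow_mul_rpow_le x y a b ha.le hb.le hab

end Algebra

/-! ### Measurability and exponential decay -/

section Measure

theorem measure_pos_ne_zero {E : Type*} [AddCommGroup E] [Module ℝ E] [MeasurableSpace E]
    {μ : Measure E} {f : E → ℝ} (hf : LogConcave f) (hpos : 0 < ∫ x, f x ∂μ) :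
    μ {x | 0 < f x} ≠ 0 := by
  intro h
  have : f =ᵐ[μ] 0 := by
    rw [Filter.EventuallyEq, ae_iff]
    refine measure_mono_null (fun x hx => ?_) h
    exact lt_of_le_of_ne (hf.nonneg x) (Ne.symm hx)
  rw [integral_congr_ae this] at hpos
  simp at hpos

theorem _root_.MeasureTheory.tendsto_setIntegral_norm_gt {E : Type*} [NormedAddCommGroup E] [MeasurableSpace E]
    [BorelSpace E] {μ : Measure E} {f : E → ℝ} (hint : Integrable f μ) :
    Tendsto (fun A : ℕ => ∫ x in {x | (A : ℝ) < ‖x‖}, f x ∂μ) atTop (𝓝 0) := by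
  have h := tendsto_setIntegral_of_antitone (μ := μ) (f := f)
    (s := fun A : ℕ => {x : E | (A : ℝ) < ‖x‖})
    (fun A => measurableSet_lt measurable_const measurable_norm)
    (fun A B hAB x hx => lt_of_le_of_lt (by exact_mod_cast hAB) (show (B : ℝ) < ‖x‖ from hx))
    ⟨0, hint.integrableOn⟩
  have he : ⋂ A : ℕ, {x : E | (A : ℝ) < ‖x‖} = ∅ := by
    refine eq_empty_of_forall_notMem fun x hx => ?_
    obtain ⟨A, hA⟩ := exists_nat_gt ‖x‖
    exact absurd (mem_iInter.1 hx A) (not_lt.2 hA.le)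
  simpa [he] using h

variable {E : Type*} [NormedAddCommGroup E] [NormedSpace ℝ E] [MeasurableSpace E] [BorelSpace E]
  [FiniteDimensional ℝ E] {μ : Measure E} [μ.IsAddHaarMeasure] {f : E → ℝ}

/-- Superlevel sets are convex, hence have null frontier and are null-measurable. On the boundary of
its support `f` can be arbitrarily bad, so only almost everywhere measurability can be expected. -/
theorem aemeasurable (hf : LogConcave f) : AEMeasurable f μ := by
  apply NullMeasurable.aemeasurable
  intro s hs
  have : MeasurableSpace.generateFrom (range (Ioi : ℝ → Set ℝ)) = borel ℝ :=
    (borel_eq_generateFrom_Ioi ℝ).symm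
  rw [BorelSpace.measurable_eq (α := ℝ), ← this] at hs
  induction s, hs using MeasurableSpace.generateFrom_induction with
  | hC t ht _ =>
    obtain ⟨r, rfl⟩ := ht
    exact (hf.convex_lt r).nullMeasurableSet μ
  | empty => simp
  | compl t _ ht => exact ht.compl
  | iUnion s _ hs => rw [preimage_iUnion]; exact NullMeasurableSet.iUnion hs

/-- Some superlevel set at a positive height has positive measure. It is convex with null frontier,
so its interior cannot be empty. -/
theorem exists_ball_le (hf : LogConcave f) (hpos : μ {x | 0 < f x} ≠ 0) :
    ∃ x₀ : E, ∃ r > 0, ∃ c > 0, ∀ x ∈ Metric.ball x₀ r, c ≤ f x := by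
  obtain ⟨k, hk⟩ : ∃ k : ℕ, μ {x | 1 / ((k : ℝ) + 1) < f x} ≠ 0 := by
    by_contra! h
    refine hpos (measure_mono_null ?_ (measure_iUnion_null h))
    intro x hx
    obtain ⟨k, hk⟩ := exists_nat_one_div_lt (show (0 : ℝ) < f x from hx)
    exact mem_iUnion.2 ⟨k, hk⟩
  have hc := hf.convex_lt (1 / ((k : ℝ) + 1))
  have hne : (interior {x | 1 / ((k : ℝ) + 1) < f x}).Nonempty := by
    by_contra h
    rw [not_nonempty_iff_eq_empty] at h
    refine hk (measure_mono_null subset_closure ?_)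
    rw [closure_eq_interior_union_frontier, h, empty_union]
    exact hc.addHaar_frontier μ
  obtain ⟨x₀, hx₀⟩ := hne
  obtain ⟨r, hr, hb⟩ := Metric.isOpen_iff.1 isOpen_interior x₀ hx₀
  refine ⟨x₀, r, hr, 1 / ((k : ℝ) + 1), by positivity, fun x hx => ?_⟩
  have : x ∈ {x | 1 / ((k : ℝ) + 1) < f x} := interior_subset (hb hx)
  exact le_of_lt this

/-- Averaging `u` with the ball around `x₀` gives a ball of half the radius on which `f ≥ √(c
f(u))`. If `u` is far away this ball lies in the tail region, so the tail mass controls `f u`. -/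
theorem le_of_ball {x₀ : E} {r c : ℝ} (hr : 0 < r) (hc : 0 < c) (hf : LogConcave f)
    (hint : Integrable f μ) (hb : ∀ x ∈ Metric.ball x₀ r, c ≤ f x) {u : E} {A : ℝ}
    (hA : 2 * (‖x₀‖ + r + A) ≤ ‖u‖) :
    (c * f u) ^ (1 / 2 : ℝ) * μ.real (Metric.ball 0 (r / 2)) ≤
      ∫ x in {x | A < ‖x‖}, f x ∂μ := by
  set z := (1 / 2 : ℝ) • x₀ + (1 / 2 : ℝ) • u
  have hz : ∀ x ∈ Metric.ball z (r / 2), (c * f u) ^ (1 / 2 : ℝ) ≤ f x := by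
    intro x hx
    have h1 : (2 : ℝ) • x - u ∈ Metric.ball x₀ r := by
      rw [Metric.mem_ball, dist_eq_norm] at hx ⊢
      have : (2 : ℝ) • x - u - x₀ = (2 : ℝ) • (x - z) := by
        simp only [z, smul_sub, smul_add, smul_smul]; norm_num; abel
      rw [this, norm_smul]
      norm_num
      linarith
    have := hf.rpow_mul_rpow_le ((2 : ℝ) • x - u) u (1 / 2) (1 / 2) (by norm_num) (by norm_num)
      (by norm_num)
    have h2 : (1 / 2 : ℝ) • ((2 : ℝ) • x - u) + (1 / 2 : ℝ) • u = x := by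
      simp [smul_sub, smul_smul]
    rw [h2] at this
    refine le_trans ?_ this
    rw [Real.mul_rpow hc.le (hf.nonneg u)]
    gcongr
    · exact Real.rpow_nonneg (hf.nonneg u) _
    · exact hb _ h1
  have hsub : Metric.ball z (r / 2) ⊆ {x | A < ‖x‖} := by
    intro x hx
    rw [Metric.mem_ball, dist_eq_norm] at hx
    have h1 : ‖z - x‖ < r / 2 := by rwa [norm_sub_rev]
    have h2 : ‖z‖ ≤ ‖z - x‖ + ‖x‖ := by simpa using norm_add_le (z - x) x
    have h3 : ‖(1 / 2 : ℝ) • u‖ ≤ ‖z‖ + ‖(1 / 2 : ℝ) • x₀‖ := by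
      have := norm_sub_le z ((1 / 2 : ℝ) • x₀)
      simpa [z] using this
    rw [norm_smul, norm_smul] at h3
    norm_num at h3
    have h4 := norm_nonneg x₀
    show A < ‖x‖
    linarith
  calc (c * f u) ^ (1 / 2 : ℝ) * μ.real (Metric.ball 0 (r / 2))
      = ∫ x in Metric.ball z (r / 2), (c * f u) ^ (1 / 2 : ℝ) ∂μ := by
        rw [setIntegral_const, smul_eq_mul, mul_comm, measureReal_def, measureReal_def,
          Measure.addHaar_ball_center μ z]
    _ ≤ ∫ x in Metric.ball z (r / 2), f x ∂μ := by
        refine setIntegral_mono_on (integrableOn_const measure_ball_lt_top.ne)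
          hint.integrableOn measurableSet_ball hz
    _ ≤ _ := setIntegral_mono_set hint.integrableOn
        (Eventually.of_forall fun x => hf.nonneg x) (LE.le.eventuallyLE hsub)

/-- An integrable log-concave function of positive mass decays exponentially. -/
theorem exists_le_exp (hf : LogConcave f) (hint : Integrable f μ) (hpos : 0 < ∫ x, f x ∂μ) :
    ∃ C > 0, ∃ a > 0, ∀ x, f x ≤ C * Real.exp (-a * ‖x‖) := by
  obtain ⟨x₀, r, hr, c, hc, hb⟩ := hf.exists_ball_le (hf.measure_pos_ne_zero hpos)
  have hv : 0 < μ.real (Metric.ball (0 : E) (r / 2)) :=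
    ENNReal.toReal_pos (Metric.measure_ball_pos μ 0 (by positivity)).ne' measure_ball_lt_top.ne
  set v := μ.real (Metric.ball (0 : E) (r / 2))
  -- global bound
  obtain ⟨M, hM⟩ : ∃ M, ∀ u, f u ≤ M := by
    refine ⟨((∫ x, f x ∂μ) / v) ^ 2 / c, fun u => ?_⟩
    -- This choice of `A` reduces the distance condition to `0 ≤ ‖u‖`.
    have h1 := hf.le_of_ball hr hc hint hb (u := u) (A := - (‖x₀‖ + r)) (by simp)
    have h2 : (c * f u) ^ (1 / 2 : ℝ) * v ≤ ∫ x, f x ∂μ :=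
      h1.trans (setIntegral_le_integral hint (Eventually.of_forall hf.nonneg))
    rw [← le_div_iff₀ hv, ← Real.sqrt_eq_rpow] at h2
    rw [le_div_iff₀ hc, mul_comm]
    calc c * f u = (Real.sqrt (c * f u)) ^ 2 :=
          (Real.sq_sqrt (mul_nonneg hc.le (hf.nonneg u))).symm
      _ ≤ _ := by gcongr
  -- smallness at infinity
  obtain ⟨R, hR, hsmall⟩ : ∃ R > 0, ∀ u, R ≤ ‖u - x₀‖ → f u ≤ c * Real.exp (-1) := by
    -- The exponent `-1 / 2` becomes `-1` once the square root is undone.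
    have hε : 0 < c * Real.exp (-1 / 2) * v := by positivity
    obtain ⟨A, hA⟩ := ((tendsto_setIntegral_norm_gt hint).eventually (gt_mem_nhds hε)).exists
    refine ⟨2 * (‖x₀‖ + r + A) + ‖x₀‖, by positivity, fun u hu => ?_⟩
    have hu' : 2 * (‖x₀‖ + r + A) ≤ ‖u‖ := by
      have := norm_sub_le u x₀
      linarith
    have h1 := (hf.le_of_ball hr hc hint hb hu').trans hA.le
    have h2 := le_of_mul_le_mul_right h1 hv
    rw [← Real.sqrt_eq_rpow] at h2
    have h3 : c * f u ≤ (c * Real.exp (-1 / 2)) ^ 2 := by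
      rw [← Real.sq_sqrt (mul_nonneg hc.le (hf.nonneg u))]
      gcongr
    have h4 : (c * Real.exp (-1 / 2)) ^ 2 = c * (c * Real.exp (-1)) := by
      rw [mul_pow, ← Real.exp_nat_mul]; norm_num; ring
    rw [h4] at h3
    exact le_of_mul_le_mul_left h3 hc
  have hcx : c ≤ f x₀ := hb x₀ (Metric.mem_ball_self hr)
  -- The point of the segment from `x₀` to `u` at distance `R` from `x₀` already has value at most
  -- `c e⁻¹`. Log-concavity propagates this drop geometrically out to `u`.
  have hfar : ∀ u, R ≤ ‖u - x₀‖ → f u ≤ c * Real.exp (-(‖u - x₀‖ / R)) := by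
    intro u hu
    have hn : 0 < ‖u - x₀‖ := hR.trans_le hu
    set t := R / ‖u - x₀‖
    have ht : 0 < t := by positivity
    have ht1 : t ≤ 1 := (div_le_one hn).2 hu
    have h1 := hsmall (t • u + (1 - t) • x₀) (by
      have : t • u + (1 - t) • x₀ - x₀ = t • (u - x₀) := by
        rw [sub_smul, one_smul, smul_sub]; abel
      rw [this, norm_smul, Real.norm_of_nonneg ht.le, div_mul_cancel₀ _ hn.ne'])
    have h2 := hf.rpow_mul_rpow_le u x₀ t (1 - t) ht.le (by linarith) (by ring)
    have h3 : f u ^ t * c ^ (1 - t) ≤ c * Real.exp (-1) := by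
      refine le_trans ?_ (h2.trans h1)
      exact mul_le_mul_of_nonneg_left (Real.rpow_le_rpow hc.le hcx (by linarith))
        (Real.rpow_nonneg (hf.nonneg u) _)
    rw [Real.rpow_sub hc, Real.rpow_one, mul_div_assoc', div_le_iff₀ (by positivity)] at h3
    have h4 : f u ^ t ≤ Real.exp (-1) * c ^ t := by
      have : c * (f u ^ t) ≤ c * (Real.exp (-1) * c ^ t) := by linarith
      exact le_of_mul_le_mul_left this hc
    have h5 : Real.exp (-1) * c ^ t = (c * Real.exp (-(‖u - x₀‖ / R))) ^ t := by
      rw [Real.mul_rpow hc.le (Real.exp_pos _).le, ← Real.exp_mul, mul_comm]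
      congr 2
      simp only [t]
      field_simp
    rw [h5] at h4
    exact (Real.rpow_le_rpow_iff (hf.nonneg u) (by positivity) ht).1 h4
  have hM0 : 0 ≤ M := (hf.nonneg x₀).trans (hM x₀)
  refine ⟨(M + c) * Real.exp (1 + ‖x₀‖ / R), by positivity, 1 / R, by positivity, fun u => ?_⟩
  have hnorm : ‖u‖ - ‖x₀‖ ≤ ‖u - x₀‖ := norm_sub_norm_le u x₀
  rw [mul_assoc, ← Real.exp_add]
  rcases le_total R ‖u - x₀‖ with hu | hu
  · refine (hfar u hu).trans ?_
    gcongr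
    · linarith
    · have : -(‖u - x₀‖ / R) ≤ -((‖u‖ - ‖x₀‖) / R) := by gcongr
      have h' : -((‖u‖ - ‖x₀‖) / R) = ‖x₀‖ / R + -(1 / R) * ‖u‖ := by ring
      linarith
  · have h1 : 0 ≤ 1 + ‖x₀‖ / R + -(1 / R) * ‖u‖ := by
      have : (‖u‖ - ‖x₀‖) / R ≤ 1 := (div_le_one hR).2 (hnorm.trans hu)
      have h' : ((‖u‖ - ‖x₀‖) / R) = -(‖x₀‖ / R) - -(1 / R) * ‖u‖ := by ring
      linarith
    have h2 : (1 : ℝ) ≤ Real.exp (1 + ‖x₀‖ / R + -(1 / R) * ‖u‖) := Real.one_le_exp h1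
    have h3 := hM u
    nlinarith

end Measure

end LogConcave

theorem integrable_exp_neg_mul_norm {E : Type*} [NormedAddCommGroup E] [NormedSpace ℝ E]
    [MeasurableSpace E] [BorelSpace E] [FiniteDimensional ℝ E] {μ : Measure E}
    [μ.IsAddHaarMeasure] {a : ℝ} (ha : 0 < a) : Integrable (fun x : E => Real.exp (-a * ‖x‖)) μ := by
  set k := Module.finrank ℝ E + 1
  have h := integrable_one_add_norm (E := E) (μ := μ) (r := (k : ℝ)) (by simp [k])
  refine (h.const_mul (k.factorial / a ^ k * Real.exp a)).mono'
    (by fun_prop) (Eventually.of_forall fun x => ?_)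
  have h1 : 0 < 1 + ‖x‖ := by positivity
  have h2 := Real.pow_div_factorial_le_exp (a * (1 + ‖x‖)) (by positivity) k
  rw [Real.norm_of_nonneg (Real.exp_pos _).le, Real.rpow_neg h1.le, Real.rpow_natCast,
    ← div_eq_mul_inv, le_div_iff₀ (by positivity), div_mul_eq_mul_div, le_div_iff₀ (by positivity)]
  rw [mul_pow, div_le_iff₀ (by positivity)] at h2
  have h3 : Real.exp (-a * ‖x‖) * Real.exp (a * (1 + ‖x‖)) = Real.exp a := by
    rw [← Real.exp_add]; ring_nf
  calc Real.exp (-a * ‖x‖) * (1 + ‖x‖) ^ k * a ^ k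
      = Real.exp (-a * ‖x‖) * (a ^ k * (1 + ‖x‖) ^ k) := by ring
    _ ≤ Real.exp (-a * ‖x‖) * (Real.exp (a * (1 + ‖x‖)) * k.factorial) := by gcongr
    _ = k.factorial * (Real.exp (-a * ‖x‖) * Real.exp (a * (1 + ‖x‖))) := by ring
    _ = _ := by rw [h3]

/-- Half of the exponential decay absorbs the factor `‖x‖`. Thus the center-of-mass condition never
holds merely because a divergent Bochner integral is `0` by default. -/
theorem LogConcave.integrable_smul_self {E : Type*} [NormedAddCommGroup E] [NormedSpace ℝ E]
    [MeasurableSpace E] [BorelSpace E] [FiniteDimensional ℝ E] {μ : Measure E}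
    [μ.IsAddHaarMeasure] {f : E → ℝ} (hf : LogConcave f) (hint : Integrable f μ)
    (hpos : 0 < ∫ x, f x ∂μ) : Integrable (fun x => f x • x) μ := by
  obtain ⟨C, hC, a, ha, hle⟩ := hf.exists_le_exp hint hpos
  have h := integrable_exp_neg_mul_norm (E := E) (μ := μ) (half_pos ha)
  refine (h.const_mul (2 * C / a)).mono' (hint.aestronglyMeasurable.smul
    aestronglyMeasurable_id) (Eventually.of_forall fun x => ?_)
  rw [norm_smul, Real.norm_of_nonneg (hf.nonneg x)]
  have h1 : a / 2 * ‖x‖ ≤ Real.exp (a / 2 * ‖x‖) := by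
    have := Real.add_one_le_exp (a / 2 * ‖x‖)
    linarith
  calc f x * ‖x‖ ≤ C * Real.exp (-a * ‖x‖) * ‖x‖ := by gcongr; exact hle x
    _ = 2 * C / a * (Real.exp (-a * ‖x‖) * (a / 2 * ‖x‖)) := by field_simp
    _ ≤ 2 * C / a * (Real.exp (-a * ‖x‖) * Real.exp (a / 2 * ‖x‖)) := by gcongr
    _ = _ := by rw [← Real.exp_add]; ring_nf

/-! ### Prékopa–Leindler on the line and log-concavity of marginals -/

/-- One-dimensional Brunn–Minkowski: `S` contains the interval from `p + q` to `p' + q'`, of length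
`(p' - p) + (q' - q)`. Taking suprema gives the sum of the diameters, which bound the volumes. -/
theorem volume_add_volume_le_of_add_mem {A B S : Set ℝ} (hA : A.Nonempty) (hB : B.Nonempty)
    (hS : S.OrdConnected) (h : ∀ p ∈ A, ∀ q ∈ B, p + q ∈ S) :
    volume A + volume B ≤ volume S := by
  have key : ∀ p ∈ A, ∀ p' ∈ A, ∀ q ∈ B, ∀ q' ∈ B, p ≤ p' → q ≤ q' →
      edist p p' + edist q q' ≤ volume S := by
    intro p hp p' hp' q hq q' hq' hpp hqq
    have h1 : Icc (p + q) (p' + q') ⊆ S := hS.out (h p hp q hq) (h p' hp' q' hq')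
    refine le_trans ?_ (measure_mono h1)
    rw [Real.volume_Icc, edist_comm p, edist_comm q, edist_dist, edist_dist, Real.dist_eq,
      Real.dist_eq, abs_of_nonneg (sub_nonneg.2 hpp), abs_of_nonneg (sub_nonneg.2 hqq),
      ← ENNReal.ofReal_add (sub_nonneg.2 hpp) (sub_nonneg.2 hqq)]
    apply ENNReal.ofReal_le_ofReal
    linarith
  have key2 : ∀ p ∈ A, ∀ p' ∈ A, ∀ q ∈ B, ∀ q' ∈ B, edist p p' + edist q q' ≤ volume S := by
    intro p hp p' hp' q hq q' hq'
    rcases le_total p p' with h1 | h1 <;> rcases le_total q q' with h2 | h2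
    · exact key p hp p' hp' q hq q' hq' h1 h2
    · rw [edist_comm q]; exact key p hp p' hp' q' hq' q hq h1 h2
    · rw [edist_comm p]; exact key p' hp' p hp q hq q' hq' h1 h2
    · rw [edist_comm p, edist_comm q]; exact key p' hp' p hp q' hq' q hq h1 h2
  refine (add_le_add (Real.volume_le_diam A) (Real.volume_le_diam B)).trans ?_
  by_cases hv : volume S = ⊤
  · simp [hv]
  have h3 : ∀ q ∈ B, ∀ q' ∈ B, Metric.ediam A + edist q q' ≤ volume S := by
    intro q hq q' hq'
    obtain ⟨p₀, hp₀⟩ := hA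
    have h4 : Metric.ediam A ≤ volume S - edist q q' := Metric.ediam_le fun p hp p' hp' =>
      ENNReal.le_sub_of_add_le_right (edist_ne_top _ _) (key2 p hp p' hp' q hq q' hq')
    have h5 : edist q q' ≤ volume S := by
      simpa using key2 p₀ hp₀ p₀ hp₀ q hq q' hq'
    calc _ ≤ volume S - edist q q' + edist q q' := by gcongr
      _ = _ := tsub_add_cancel_of_le h5
  have hdA : Metric.ediam A ≤ volume S := by
    obtain ⟨q, hq⟩ := hB
    simpa using h3 q hq q hq
  have h6 : Metric.ediam B ≤ volume S - Metric.ediam A := Metric.ediam_le fun q hq q' hq' =>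
    ENNReal.le_sub_of_add_le_left (ne_top_of_le_ne_top hv hdA) (h3 q hq q' hq')
  calc _ ≤ Metric.ediam A + (volume S - Metric.ediam A) := by gcongr
    _ = _ := add_tsub_cancel_of_le hdA

/-- The Prékopa–Leindler inequality on the line, in arithmetic form, for functions with
supremum `1`. -/
theorem lintegral_combo_le_of_sup_eq_one {φ ψ h : ℝ → ℝ} (hφ : AEMeasurable φ)
    (hψ : AEMeasurable ψ) (hh : AEMeasurable h) (hφ0 : ∀ s, 0 ≤ φ s) (hψ0 : ∀ s, 0 ≤ ψ s)
    (hh0 : ∀ s, 0 ≤ h s) (hφ1 : ∀ s, φ s ≤ 1) (hψ1 : ∀ s, ψ s ≤ 1)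
    (hφs : ∀ r < 1, ∃ s, r < φ s) (hψs : ∀ r < 1, ∃ s, r < ψ s)
    (hconv : ∀ r, {s | r < h s}.OrdConnected) {a b : ℝ} (ha : 0 < a) (hb : 0 < b)
    (hab : a + b = 1) (hle : ∀ s t, φ s ^ a * ψ t ^ b ≤ h (a * s + b * t)) :
    ENNReal.ofReal a * (∫⁻ s, ENNReal.ofReal (φ s)) +
      ENNReal.ofReal b * (∫⁻ s, ENNReal.ofReal (ψ s)) ≤ ∫⁻ s, ENNReal.ofReal (h s) := by
  rw [lintegral_eq_lintegral_meas_lt _ (Eventually.of_forall hφ0) hφ,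
    lintegral_eq_lintegral_meas_lt _ (Eventually.of_forall hψ0) hψ,
    lintegral_eq_lintegral_meas_lt _ (Eventually.of_forall hh0) hh,
    ← lintegral_const_mul' _ _ ENNReal.ofReal_ne_top,
    ← lintegral_const_mul' _ _ ENNReal.ofReal_ne_top, ← lintegral_add_left]
  · refine lintegral_mono_ae ?_
    filter_upwards [ae_restrict_mem measurableSet_Ioi] with r hr
    have hr0 : (0 : ℝ) < r := hr
    -- Layer by layer: below height `1` both superlevel sets are non-empty, as Brunn–Minkowski
    -- needs, and from `1` on both are empty. This is the purpose of equal suprema.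
    rcases lt_or_ge r 1 with h1 | h1
    · have hvol : ∀ c : ℝ, 0 < c → ∀ T : Set ℝ,
          volume ((c * ·) '' T) = ENNReal.ofReal c * volume T := by
        intro c hc T
        have := Measure.addHaar_smul (volume : Measure ℝ) c T
        rwa [Module.finrank_self, pow_one, abs_of_pos hc] at this
      rw [← hvol a ha, ← hvol b hb]
      obtain ⟨s₀, hs₀⟩ := hφs r h1
      obtain ⟨t₀, ht₀⟩ := hψs r h1
      refine volume_add_volume_le_of_add_mem ⟨_, s₀, hs₀, rfl⟩ ⟨_, t₀, ht₀, rfl⟩ (hconv r) ?_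
      rintro _ ⟨s, hs, rfl⟩ _ ⟨t, ht, rfl⟩
      refine lt_of_lt_of_le ?_ (hle s t)
      calc r = r ^ a * r ^ b := by rw [← Real.rpow_add hr0, hab, Real.rpow_one]
        _ < φ s ^ a * ψ t ^ b := by
          apply mul_lt_mul'' (Real.rpow_lt_rpow hr0.le hs ha) (Real.rpow_lt_rpow hr0.le ht hb)
            <;> positivity
    · have hA : {s | r < φ s} = ∅ := eq_empty_of_forall_notMem fun s hs =>
        absurd (hφ1 s) (not_le.2 (h1.trans_lt hs))
      have hB : {s | r < ψ s} = ∅ := eq_empty_of_forall_notMem fun s hs =>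
        absurd (hψ1 s) (not_le.2 (h1.trans_lt hs))
      simp [hA, hB]
  · refine Measurable.const_mul ?_ _
    exact Antitone.measurable fun r r' hr => measure_mono fun s hs => lt_of_le_of_lt hr hs

/-- Marginals of log-concave functions along a line are log-concave. -/
theorem LogConcave.marginal {E : Type*} [AddCommGroup E] [Module ℝ E] {g : E × ℝ → ℝ}
    (hg : LogConcave g) (hint : ∀ x, Integrable fun s => g (x, s)) {M : ℝ} (hM : ∀ p, g p ≤ M) :
    LogConcave fun x => ∫ s, g (x, s) := by
  refine mk_of_pos (fun x => integral_nonneg fun s => hg.nonneg _) ?_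
  intro x y hx hy a b ha hb hab
  have hbdd : ∀ z, BddAbove (range fun s => g (z, s)) := fun z =>
    ⟨M, by rintro _ ⟨s, rfl⟩; exact hM _⟩
  have hsup : ∀ z, 0 < ∫ s, g (z, s) → 0 < ⨆ s, g (z, s) := by
    intro z hz
    by_contra! h
    have : ∀ s, g (z, s) ≤ 0 := fun s => (le_ciSup (hbdd z) s).trans h
    exact absurd hz (not_lt.2 (integral_nonpos this))
  set P := ⨆ s, g (x, s)
  set Q := ⨆ s, g (y, s)
  have hP : 0 < P := hsup x hx
  have hQ : 0 < Q := hsup y hy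
  set K := P ^ a * Q ^ b
  have hK : 0 < K := by positivity
  have hlc : ∀ z, LogConcave fun s => g (z, s) := fun z => by
    have := hg.comp_affine (LinearMap.inr ℝ E ℝ) (z, 0)
    simpa using this
  have key := lintegral_combo_le_of_sup_eq_one (φ := fun s => g (x, s) / P)
    (ψ := fun s => g (y, s) / Q) (h := fun s => g (a • x + b • y, s) / K)
    ((hint x).aemeasurable.div_const _) ((hint y).aemeasurable.div_const _)
    ((hint _).aemeasurable.div_const _) (fun s => div_nonneg (hg.nonneg _) hP.le)
    (fun s => div_nonneg (hg.nonneg _) hQ.le) (fun s => div_nonneg (hg.nonneg _) hK.le)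
    (fun s => (div_le_one hP).2 (le_ciSup (hbdd x) s))
    (fun s => (div_le_one hQ).2 (le_ciSup (hbdd y) s))
    (fun r hr => by
      obtain ⟨s, hs⟩ := exists_lt_of_lt_ciSup (show r * P < P by nlinarith)
      exact ⟨s, (lt_div_iff₀ hP).2 hs⟩)
    (fun r hr => by
      obtain ⟨s, hs⟩ := exists_lt_of_lt_ciSup (show r * Q < Q by nlinarith)
      exact ⟨s, (lt_div_iff₀ hQ).2 hs⟩)
    (fun r => by
      have := ((hlc (a • x + b • y)).convex_lt (r * K)).ordConnected
      simpa only [lt_div_iff₀ hK] using this) ha hb hab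
    (fun s t => by
      rw [Real.div_rpow (hg.nonneg _) hP.le, Real.div_rpow (hg.nonneg _) hQ.le, div_mul_div_comm]
      exact div_le_div_of_nonneg_right
        (hg.rpow_mul_rpow_le (x, s) (y, t) a b ha.le hb.le hab) hK.le)
  rw [← ofReal_integral_eq_lintegral_ofReal ((hint x).div_const _)
      (Eventually.of_forall fun s => div_nonneg (hg.nonneg _) hP.le),
    ← ofReal_integral_eq_lintegral_ofReal ((hint y).div_const _)
      (Eventually.of_forall fun s => div_nonneg (hg.nonneg _) hQ.le),
    ← ofReal_integral_eq_lintegral_ofReal ((hint _).div_const _)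
      (Eventually.of_forall fun s => div_nonneg (hg.nonneg _) hK.le),
    integral_div, integral_div, integral_div, ← ENNReal.ofReal_mul ha.le,
    ← ENNReal.ofReal_mul hb.le, ← ENNReal.ofReal_add (by positivity) (by positivity),
    ENNReal.ofReal_le_ofReal_iff
      (div_nonneg (integral_nonneg fun s => hg.nonneg _) hK.le)] at key
  -- AM–GM turns the arithmetic bound for the normalised functions into the multiplicative one, and
  -- the factors `P ^ a * Q ^ b` cancel.
  have amgm := Real.geom_mean_le_arith_mean2_weighted ha.le hb.le
    (show 0 ≤ (∫ s, g (x, s)) / P by positivity) (show 0 ≤ (∫ s, g (y, s)) / Q by positivity) hab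
  have h1 := amgm.trans key
  rw [Real.div_rpow hx.le hP.le, Real.div_rpow hy.le hQ.le, div_mul_div_comm] at h1
  exact (div_le_div_iff_of_pos_right hK).1 h1

/-! ### Logarithmic tail estimate in one dimension -/

/-- If `F t = ∫_t^∞ g`, then the mass that `g` gives to `{F < v}` is at most `v`. -/
theorem withDensity_setIntegral_Ioi_lt_le {g : ℝ → ℝ} (hg0 : ∀ s, 0 ≤ g s) (hg : Integrable g)
    (v : ℝ) : (volume.withDensity fun s => ENNReal.ofReal (g s)) {t | ∫ s in Ioi t, g s < v} ≤
      ENNReal.ofReal v := by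
  set ν := volume.withDensity fun s => ENNReal.ofReal (g s)
  set D := {t | ∫ s in Ioi t, g s < v}
  have hν : ∀ t, ν (Ioi t) = ENNReal.ofReal (∫ s in Ioi t, g s) := fun t => by
    rw [withDensity_apply _ measurableSet_Ioi, ofReal_integral_eq_lintegral_ofReal hg.integrableOn
      (Eventually.of_forall hg0)]
  have hac : ν ≪ volume := withDensity_absolutelyContinuous _ _
  have hup : ∀ s ∈ D, ∀ t, s ≤ t → t ∈ D := fun s hs t hst =>
    (setIntegral_mono_set hg.integrableOn (Eventually.of_forall hg0)
      (Ioi_subset_Ioi hst).eventuallyLE).trans_lt hs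
  -- `D` is an up-set, so up to its infimum, which carries no mass, it is an increasing union of
  -- rays based at points of `D`. Each such ray has mass below `v`.
  have hseq : ∀ u : ℕ → ℝ, Antitone u → (∀ k, u k ∈ D) →
      ν (⋃ k, Ioi (u k)) ≤ ENNReal.ofReal v := by
    intro u hu hD
    have hm : Monotone fun k => Ioi (u k) := fun i j hij => Ioi_subset_Ioi (hu hij)
    rw [hm.measure_iUnion]
    refine iSup_le fun k => ?_
    rw [hν]
    exact ENNReal.ofReal_le_ofReal (le_of_lt (hD k))
  rcases D.eq_empty_or_nonempty with hD | hD
  · simp [hD]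
  by_cases hb : BddBelow D
  · obtain ⟨u, hu, hlim, huD⟩ := exists_seq_tendsto_sInf hD hb
    have hsub : D ⊆ {sInf D} ∪ ⋃ k, Ioi (u k) := by
      intro t ht
      rcases (csInf_le hb ht).eq_or_lt with h | h
      · exact Or.inl h.symm
      · obtain ⟨k, hk⟩ := (hlim.eventually (gt_mem_nhds h)).exists
        exact Or.inr (mem_iUnion.2 ⟨k, hk⟩)
    calc ν D ≤ ν {sInf D} + ν (⋃ k, Ioi (u k)) := (measure_mono hsub).trans (measure_union_le _ _)
      _ ≤ 0 + ENNReal.ofReal v := by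
        gcongr
        · exact (hac (measure_singleton _)).le
        · exact hseq u hu huD
      _ = _ := zero_add _
  · refine (measure_mono fun t _ => ?_).trans
      (hseq (fun k : ℕ => -(k : ℝ)) (fun i j h => by simpa using h) fun k => ?_)
    · obtain ⟨k, hk⟩ := exists_nat_gt (-t)
      exact mem_iUnion.2 ⟨k, by simpa using neg_lt.1 hk⟩
    · rw [not_bddBelow_iff] at hb
      obtain ⟨s, hs, hsk⟩ := hb (-(k : ℝ))
      exact hup s hs _ hsk.le

/-- The `g`-mass of `{F < I e^{-r}}` is at most `I e^{-r}`. The layer-cake formula integrates this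
over `r > 0` to `I`. -/
theorem lintegral_mul_log_div_setIntegral_Ioi_le {g : ℝ → ℝ} (hg0 : ∀ s, 0 ≤ g s)
    (hg : Integrable g) :
    ∫⁻ t, ENNReal.ofReal (g t) * ENNReal.ofReal (Real.log ((∫ s, g s) / ∫ s in Ioi t, g s)) ≤
      ENNReal.ofReal (∫ s, g s) := by
  set I := ∫ s, g s
  set F := fun t => ∫ s in Ioi t, g s
  set ν := volume.withDensity fun s => ENNReal.ofReal (g s)
  have hI : 0 ≤ I := integral_nonneg hg0
  have hF0 : ∀ t, 0 ≤ F t := fun t => integral_nonneg hg0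
  have hFI : ∀ t, F t ≤ I := fun t => setIntegral_le_integral hg (Eventually.of_forall hg0)
  have hanti : Antitone F := fun s t hst => setIntegral_mono_set hg.integrableOn
    (Eventually.of_forall hg0) (Ioi_subset_Ioi hst).eventuallyLE
  have hFm : Measurable F := hanti.measurable
  have hφm : Measurable fun t => Real.log (I / F t) := (hFm.const_div I).log
  have hφ0 : ∀ t, 0 ≤ Real.log (I / F t) := fun t => by
    rcases (hF0 t).eq_or_lt with h | h
    · simp [← h]
    · exact Real.log_nonneg ((one_le_div h).2 (hFI t))
  have h1 := lintegral_withDensity_eq_lintegral_mul₀ (μ := volume)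
    (f := fun s => ENNReal.ofReal (g s)) hg.aemeasurable.ennreal_ofReal
    (g := fun t => ENNReal.ofReal (Real.log (I / F t))) hφm.ennreal_ofReal.aemeasurable
  simp only [Pi.mul_apply] at h1
  rw [← h1, lintegral_eq_lintegral_meas_lt _ (Eventually.of_forall hφ0) hφm.aemeasurable]
  have h2 : ∀ r ∈ Ioi (0 : ℝ), ν {t | r < Real.log (I / F t)} ≤
      ENNReal.ofReal (I * Real.exp (-r)) := by
    intro r hr
    refine (measure_mono fun t ht => ?_).trans (withDensity_setIntegral_Ioi_lt_le hg0 hg _)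
    have hr0 : (0 : ℝ) < r := hr
    have ht' : r < Real.log (I / F t) := ht
    -- Where `F t = 0`, the default values `I / 0 = 0` and `log 0 = 0` exclude `t` from the set.
    have hF : 0 < F t := (hF0 t).lt_of_ne fun h => by
      rw [← h] at ht'; simp at ht'; linarith
    have hIp : 0 < I := hF.trans_le (hFI t)
    have := (Real.lt_log_iff_exp_lt (by positivity)).1 ht'
    rw [lt_div_iff₀ hF] at this
    show F t < I * Real.exp (-r)
    rw [Real.exp_neg, ← div_eq_mul_inv, lt_div_iff₀ (Real.exp_pos r)]
    linarith
  refine (setLIntegral_mono' measurableSet_Ioi h2).trans ?_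
  rw [← ofReal_integral_eq_lintegral_ofReal]
  · rw [integral_const_mul, integral_exp_neg_Ioi]; simp
  · exact (integrableOn_exp_neg_Ioi 0).const_mul I
  · exact Eventually.of_forall fun r => by positivity

/-! ### Entropy of log-concave functions by dilation -/

/-- If `l ↦ l⁻ᵐ I - I + (l - 1) J` is non-negative to the left of `1`, then `J ≤ m I`. -/
theorem le_mul_of_inv_pow_bound {m : ℕ} {I J : ℝ}
    (h : ∀ l ∈ Ioo (0 : ℝ) 1, (1 - l) * J ≤ (l ^ m)⁻¹ * I - I) : J ≤ m * I := by
  have hd : HasDerivAt (fun l : ℝ => (l ^ m)⁻¹ * I) (-(m * I)) 1 := by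
    have h1 := ((hasDerivAt_pow m (1 : ℝ)).inv (by simp)).mul_const I
    convert! h1 using 1
    simp
  have hs := hd.tendsto_slope.mono_left (nhdsWithin_mono (1 : ℝ)
    (show Iio (1 : ℝ) ⊆ {1}ᶜ from fun x (hx : x < 1) => hx.ne))
  have h2 : -(m * I) ≤ -J := by
    refine le_of_tendsto hs ?_
    filter_upwards [Ioo_mem_nhdsLT (zero_lt_one' ℝ)] with l hl
    have h3 := h l hl
    have h4 : 0 < 1 - l := by linarith [hl.2]
    rw [slope_def_field, ← neg_div_neg_eq, neg_sub l 1, div_le_iff₀ h4]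
    simp only [one_pow, inv_one, one_mul]
    linarith
  linarith

section Entropy

/-- Interpolating between `y` and `0` gives `G(ly) ≥ G(y) e^{(1-l) log (G(0)/G(y))}`. Then use `e^u
≥ 1 + u`. -/
theorem LogConcave.mul_log_le {V : Type*} [AddCommGroup V] [Module ℝ V] {G : V → ℝ} (hG : LogConcave G) (h0 : 0 < G 0) {l : ℝ} (hl : 0 ≤ l)
    (hl1 : l ≤ 1) (y : V) : (1 - l) * (G y * Real.log (G 0 / G y)) ≤ G (l • y) - G y := by
  rcases (hG.nonneg y).eq_or_lt with hy | hy
  · simpa [← hy] using hG.nonneg (l • y)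
  have h1 := hG.rpow_mul_rpow_le y 0 l (1 - l) hl (by linarith) (by ring)
  rw [smul_zero, add_zero] at h1
  have h2 : G y ^ l * G 0 ^ (1 - l) = G y * Real.exp ((1 - l) * Real.log (G 0 / G y)) := by
    rw [mul_comm (1 - l), ← Real.rpow_def_of_pos (by positivity), Real.div_rpow h0.le hy.le,
      Real.rpow_sub hy, Real.rpow_one]
    field_simp
  rw [h2] at h1
  have h3 := mul_le_mul_of_nonneg_left (Real.add_one_le_exp ((1 - l) * Real.log (G 0 / G y))) hy.le
  linarith

variable {V : Type*} [NormedAddCommGroup V] [NormedSpace ℝ V] [MeasurableSpace V] [BorelSpace V]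
  [FiniteDimensional ℝ V] {μ : Measure V} [μ.IsAddHaarMeasure] {G : V → ℝ}

/-- The dilation inequality at `l = 1/2` bounds the integrand from above, and `log u ≤ u - 1` with
`G ≤ M` bounds it from below. -/
theorem LogConcave.integrable_mul_log (hG : LogConcave G) (hint : Integrable G μ) (h0 : 0 < G 0)
    {M : ℝ} (hM : ∀ y, G y ≤ M) : Integrable (fun y => G y * Real.log (G 0 / G y)) μ := by
  have hi2 := (hint.comp_smul (R := (1 / 2 : ℝ)) (by norm_num))
  refine ((hi2.const_mul 2).add (hint.const_mul (M / G 0))).mono' ?_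
    (Eventually.of_forall fun y => ?_)
  · have := hG.aemeasurable (μ := μ)
    exact (this.mul (this.const_div _).log).aestronglyMeasurable
  have hM0 : 0 < M := h0.trans_le (hM 0)
  have h1 := hG.mul_log_le h0 (l := 1 / 2) (by norm_num) (by norm_num) y
  have h2 := hG.nonneg y
  have h5 := hG.nonneg ((1 / 2 : ℝ) • y)
  have h3 : -(M / G 0 * G y) ≤ G y * Real.log (G 0 / G y) := by
    rcases h2.eq_or_lt with hy | hy
    · simp [← hy]
    have h4 := Real.log_le_sub_one_of_pos (show 0 < G y / G 0 by positivity)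
    rw [← inv_div (G y), Real.log_inv]
    have h6 : G y / G 0 ≤ M / G 0 := by gcongr; exact hM y
    nlinarith
  have h7 : 0 ≤ M / G 0 * G y := by positivity
  simp only [Pi.add_apply, Real.norm_eq_abs]
  rw [abs_le]
  constructor <;> linarith

/-- A lower bound for the entropy of a log-concave function. -/
theorem LogConcave.integral_mul_log_le (hG : LogConcave G) (hint : Integrable G μ) (h0 : 0 < G 0)
    {M : ℝ} (hM : ∀ y, G y ≤ M) :
    ∫ y, G y * Real.log (G 0 / G y) ∂μ ≤ Module.finrank ℝ V * ∫ y, G y ∂μ := by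
  -- Dilation by `l` multiplies the integral of `G` by `l⁻ᵐ` with `m = dim V`. The bound is the
  -- comparison of slopes as `l → 1⁻`.
  refine le_mul_of_inv_pow_bound fun l hl => ?_
  have hi := hint.comp_smul hl.1.ne'
  have := integral_mono ((hG.integrable_mul_log hint h0 hM).const_mul (1 - l)) (hi.sub hint)
    (hG.mul_log_le h0 hl.1.le hl.2.le)
  simp only [Pi.sub_apply] at this
  rwa [integral_const_mul, integral_sub hi hint, Measure.integral_comp_smul_of_nonneg _ _ _
    (hR := hl.1.le), smul_eq_mul] at this

end Entropy

/-! ### Jensen's inequality at the center of mass -/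

section Barycenter

variable {E : Type*} [NormedAddCommGroup E] [NormedSpace ℝ E] [MeasurableSpace E] [BorelSpace E]
  [FiniteDimensional ℝ E] {μ : Measure E} [μ.IsAddHaarMeasure] {f Φ : E → ℝ}

/-- Positivity of `Φ` is part of the set because `Real.log 0 = 0` would otherwise add spurious
points. -/
theorem LogConcave.convex_hypograph {E : Type*} [AddCommGroup E] [Module ℝ E] {Φ : E → ℝ}
    (hΦ : LogConcave Φ) : Convex ℝ {p : E × ℝ | 0 < Φ p.1 ∧ p.2 < Real.log (Φ p.1)} := by
  rintro p ⟨hp, hp'⟩ q ⟨hq, hq'⟩ a b ha hb hab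
  refine ⟨hΦ.pos_combo hp hq ha hb hab, ?_⟩
  refine lt_of_lt_of_le ?_ (hΦ.log_combo hp hq ha hb hab)
  show a * p.2 + b * q.2 < _
  rcases ha.eq_or_lt with rfl | ha
  · obtain rfl : b = 1 := by linarith
    linarith
  · nlinarith

/-- The integral of `f l` is `l` applied to the zero first moment, so the a.e. non-positive `f l`
vanishes a.e., and the hyperplane `l = 0` is null. This excludes vertical separating hyperplanes in
Jensen's inequality. -/
theorem integral_eq_zero_of_integral_mul_dual_eq_zero (hf0 : ∀ x, 0 ≤ f x)
    (hx : Integrable (fun x => f x • x) μ) (hcen : ∫ x, f x • x ∂μ = 0) {l : E →L[ℝ] ℝ}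
    (hl : l ≠ 0) (hle : ∀ᵐ x ∂μ, 0 < f x → l x ≤ 0) : ∫ x, f x ∂μ = 0 := by
  have h1 : ∫ x, -(f x * l x) ∂μ = 0 := by
    have := l.integral_comp_comm hx
    rw [hcen, map_zero] at this
    simpa [integral_neg] using this
  have hi : Integrable (fun x => -(f x * l x)) μ := by
    simpa using (l.integrable_comp hx).neg
  have h2 := (integral_eq_zero_iff_of_nonneg_ae (by
    filter_upwards [hle] with x hx
    rcases (hf0 x).eq_or_lt with h | h
    · simp [← h]
    · have := hx h
      show 0 ≤ -(f x * l x)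
      nlinarith) hi).1 h1
  have hker : ∀ᵐ x ∂μ, l x ≠ 0 := by
    have := Measure.addHaar_submodule μ (LinearMap.ker (l : E →ₗ[ℝ] ℝ)) (fun h => hl (by
      ext x
      have : x ∈ LinearMap.ker (l : E →ₗ[ℝ] ℝ) := h ▸ Submodule.mem_top
      simpa using this))
    rw [ae_iff]
    refine measure_mono_null (fun x hx => ?_) this
    simpa using hx
  refine integral_eq_zero_of_ae ?_
  filter_upwards [h2, hker] with x h3 h4
  simpa [h4] using h3

/-- Jensen's inequality for a log-concave function at a center of mass. -/
theorem LogConcave.integral_mul_log_le_of_centered (hΦ : LogConcave Φ) (hf0 : ∀ x, 0 ≤ f x)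
    (hf : Integrable f μ) (hpos : 0 < ∫ x, f x ∂μ) (hx : Integrable (fun x => f x • x) μ)
    (hcen : ∫ x, f x • x ∂μ = 0) (hΦpos : ∀ᵐ x ∂μ, 0 < f x → 0 < Φ x)
    (hlog : Integrable (fun x => f x * Real.log (Φ x)) μ) {c : ℝ} (hΦ0 : Φ 0 ≤ c) :
    ∫ x, f x * Real.log (Φ x) ∂μ ≤ Real.log c * ∫ x, f x ∂μ := by
  set S := {p : E × ℝ | 0 < Φ p.1 ∧ p.2 < Real.log (Φ p.1)}
  have hne : μ {x | 0 < Φ x} ≠ 0 := by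
    intro h
    have : f =ᵐ[μ] 0 := by
      have h' : ∀ᵐ x ∂μ, ¬ 0 < Φ x := by simpa [ae_iff] using h
      filter_upwards [hΦpos, h'] with x h1 h2
      exact le_antisymm (not_lt.1 fun h3 => h2 (h1 h3)) (hf0 x)
    rw [integral_congr_ae this] at hpos
    simp at hpos
  obtain ⟨x₀, r, hr, c₀, hc₀, hb⟩ := hΦ.exists_ball_le hne
  have hint : (interior S).Nonempty := by
    refine ⟨(x₀, Real.log c₀ - 1), mem_interior.2 ⟨Metric.ball x₀ r ×ˢ Iio (Real.log c₀), ?_,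
      Metric.isOpen_ball.prod isOpen_Iio, Metric.mem_ball_self hr, by simp⟩⟩
    rintro ⟨x, s⟩ ⟨hx, hs⟩
    have h1 := hb x hx
    exact ⟨hc₀.trans_le h1, lt_of_lt_of_le hs (Real.log_le_log hc₀ h1)⟩
  -- Using a level `c ≥ Φ 0` instead of `Φ 0` itself allows `Φ 0 = 0`.
  have h0 : ((0 : E), Real.log c) ∉ S := by
    rintro ⟨h1, h2⟩
    exact absurd (Real.log_le_log h1 hΦ0) (not_le.2 h2)
  obtain ⟨L, hL, hle⟩ := geometric_hahn_banach_of_nonempty_interior_point hΦ.convex_hypograph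
    (fun h => h0 (interior_subset h)) hint
  set l := L.comp (ContinuousLinearMap.inl ℝ E ℝ)
  set α := L (0, 1)
  have hLapp : ∀ x s, L (x, s) = l x + s * α := by
    intro x s
    have : ((x, s) : E × ℝ) = (x, 0) + s • (0, 1) := by simp
    rw [this, map_add, map_smul]
    rfl
  have key : ∀ x s, 0 < Φ x → s < Real.log (Φ x) → l x + s * α ≤ Real.log c * α := by
    intro x s h1 h2
    have := hle (x, s) ⟨h1, h2⟩
    rwa [hLapp, hLapp, map_zero, zero_add] at this
  have hx₀ : 0 < Φ x₀ := hc₀.trans_le (hb x₀ (Metric.mem_ball_self hr))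
  -- The hypograph is unbounded downwards.
  have hα : 0 ≤ α := by
    by_contra! hα
    obtain ⟨k, hk⟩ := exists_nat_gt
      ((Real.log c * α - l x₀ - (Real.log (Φ x₀) - 1) * α) / (-α))
    rw [div_lt_iff₀ (by linarith)] at hk
    have hk0 : (0 : ℝ) ≤ k := k.cast_nonneg
    have := key x₀ (Real.log (Φ x₀) - 1 - k) hx₀ (by linarith)
    nlinarith
  rcases hα.eq_or_lt with hα | hα
  · exfalso
    have hl : l ≠ 0 := by
      intro h
      apply hL
      refine ContinuousLinearMap.ext fun ⟨x, s⟩ => ?_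
      rw [hLapp, h, ← hα]
      simp
    refine hpos.ne' (integral_eq_zero_of_integral_mul_dual_eq_zero hf0 hx hcen hl ?_)
    filter_upwards [hΦpos] with x hx hfx
    have := key x (Real.log (Φ x) - 1) (hx hfx) (by linarith)
    rw [← hα] at this
    simpa using this
  -- A non-vertical hyperplane is an affine majorant of `log Φ`. Its linear part integrates to zero
  -- against `f`.
  · have key2 : ∀ x, 0 < Φ x → Real.log (Φ x) ≤ Real.log c - l x / α := by
      intro x h1
      refine le_of_forall_lt fun s hs => ?_
      obtain ⟨s', hs', hs''⟩ := exists_between hs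
      have := key x s' h1 hs''
      refine hs'.trans_le ?_
      rw [le_sub_iff_add_le, ← le_sub_iff_add_le', div_le_iff₀ hα]
      linarith
    have hi : Integrable (fun x => f x * l x) μ := by
      simpa using l.integrable_comp hx
    have h1 : ∫ x, f x * l x ∂μ = 0 := by
      have := l.integral_comp_comm hx
      rw [hcen, map_zero] at this
      simpa using this
    calc ∫ x, f x * Real.log (Φ x) ∂μ
        ≤ ∫ x, (Real.log c * f x - f x * l x / α) ∂μ := by
          refine integral_mono_ae hlog ((hf.const_mul _).sub (hi.div_const _)) ?_
          filter_upwards [hΦpos] with x hx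
          rcases (hf0 x).eq_or_lt with h | h
          · simp [← h]
          · have := mul_le_mul_of_nonneg_left (key2 x (hx h)) h.le
            have h' : f x * (Real.log c - l x / α) = Real.log c * f x - f x * l x / α := by ring
            rwa [h'] at this
      _ = _ := by
        rw [integral_sub (hf.const_mul _) (hi.div_const _), integral_const_mul, integral_div, h1]
        simp

end Barycenter

/-! ### The inequality on a product `ℝ × V` -/

theorem LogConcave.pos_of_mem_Icc {g : ℝ → ℝ} (hg : LogConcave g) (hi : Integrable g) {s t : ℝ}
    (hst : s < t) (hs : 0 < g s) (ht : 0 < g t) : 0 < ∫ u in Ioi s, g u := by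
  have h1 : ∀ u ∈ Ioc s t, min (g s) (g t) ≤ g u := by
    intro u hu
    have h := hg.min_le s t (a := (t - u) / (t - s)) (b := (u - s) / (t - s))
      (div_nonneg (by linarith [hu.2]) (by linarith))
      (div_nonneg (by linarith [hu.1]) (by linarith))
      (by rw [← add_div, div_eq_one_iff_eq (by linarith)]; ring)
    have h2 : ((t - u) / (t - s)) • s + ((u - s) / (t - s)) • t = u := by
      have : t - s ≠ 0 := by linarith
      simp only [smul_eq_mul]
      field_simp
      ring
    rwa [h2] at h
  calc 0 < (t - s) * min (g s) (g t) := mul_pos (by linarith) (lt_min hs ht)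
    _ = ∫ u in Ioc s t, min (g s) (g t) := by
      rw [setIntegral_const, measureReal_def, Real.volume_Ioc,
        ENNReal.toReal_ofReal (by linarith), smul_eq_mul]
    _ ≤ ∫ u in Ioc s t, g u := setIntegral_mono_on (integrableOn_const (by simp))
        hi.integrableOn measurableSet_Ioc h1
    _ ≤ _ := setIntegral_mono_set hi.integrableOn (Eventually.of_forall hg.nonneg)
        (LE.le.eventuallyLE Ioc_subset_Ioi_self)

section Prod

theorem LogConcave.comp_prodMk_right {V : Type*} [AddCommGroup V] [Module ℝ V] {f : ℝ × V → ℝ}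
    (hf : LogConcave f) (y : V) : LogConcave fun s => f (s, y) := by
  simpa using hf.comp_affine (LinearMap.inl ℝ ℝ V) (0, y)

/-- Fubini would give integrability on almost every fibre only. The decay gives every fibre, in
particular `y = 0`, with a uniform bound. -/
theorem integrable_prodMk_right_of_le_exp {V : Type*} [NormedAddCommGroup V] [NormedSpace ℝ V]
    {f : ℝ × V → ℝ} (hf : LogConcave f) {C a : ℝ} (hC : 0 < C) (ha : 0 < a)
    (hle : ∀ x, f x ≤ C * Real.exp (-a * ‖x‖)) (y : V) :
    Integrable (fun s => f (s, y)) ∧ ∫ s, f (s, y) ≤ ∫ s : ℝ, C * Real.exp (-a * ‖s‖) := by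
  have hi : Integrable fun s : ℝ => C * Real.exp (-a * ‖s‖) :=
    (integrable_exp_neg_mul_norm ha).const_mul C
  have hb : ∀ s, f (s, y) ≤ C * Real.exp (-a * ‖s‖) := fun s => (hle _).trans (by
    have h1 : ‖s‖ ≤ ‖(s, y)‖ := norm_fst_le (s, y)
    have h2 : -a * ‖(s, y)‖ ≤ -a * ‖s‖ := by nlinarith
    gcongr)
  have h3 : Integrable (fun s => f (s, y)) :=
    hi.mono' (hf.comp_prodMk_right y).aemeasurable.aestronglyMeasurable
      (Eventually.of_forall fun s => by
        rw [Real.norm_of_nonneg (hf.nonneg _)]; exact hb s)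
  exact ⟨h3, integral_mono h3 hi hb⟩

variable {V : Type*} [NormedAddCommGroup V] [NormedSpace ℝ V] [MeasurableSpace V] [BorelSpace V]
  [FiniteDimensional ℝ V] {μ : Measure V} [μ.IsAddHaarMeasure] {f : ℝ × V → ℝ}

theorem LogConcave.integral_fst {V : Type*} [AddCommGroup V] [Module ℝ V] {f : ℝ × V → ℝ}
    (hf : LogConcave f) (hi : ∀ y, Integrable fun s => f (s, y)) {M : ℝ} (hM : ∀ p, f p ≤ M) :
    LogConcave fun y => ∫ s, f (s, y) := by
  have h := hf.comp_affine (LinearEquiv.prodComm ℝ V ℝ).toLinearMap 0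
  have := LogConcave.marginal (g := fun p : V × ℝ => f (p.2, p.1)) (by simpa using! h) hi
    (fun p => hM _)
  exact this

/-- This is the marginal in `s` of `f (s, y)` cut off to the convex set `t < s` in the variables
`((t, y), s)`. -/
theorem LogConcave.setIntegral_Ioi_fst {V : Type*} [AddCommGroup V] [Module ℝ V] {f : ℝ × V → ℝ}
    (hf : LogConcave f) (hi : ∀ y, Integrable fun s => f (s, y)) {M : ℝ} (hM : ∀ p, f p ≤ M) :
    LogConcave fun p : ℝ × V => ∫ s in Ioi p.1, f (s, p.2) := by
  set T : Set ((ℝ × V) × ℝ) := {p | p.1.1 < p.2}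
  have hT : Convex ℝ T := by
    intro p hp q hq a b ha hb hab
    have h1 : p.1.1 < p.2 := hp
    have h2 : q.1.1 < q.2 := hq
    show a * p.1.1 + b * q.1.1 < a * p.2 + b * q.2
    rcases ha.eq_or_lt with rfl | ha
    · obtain rfl : b = 1 := by linarith
      linarith
    · nlinarith
  have h := (hf.comp_affine ((LinearMap.snd ℝ (ℝ × V) ℝ).prod
    ((LinearMap.snd ℝ ℝ V).comp (LinearMap.fst ℝ (ℝ × V) ℝ))) 0).indicator hT
  have heq : ∀ p : ℝ × V, (fun s => T.indicator (fun q : (ℝ × V) × ℝ => f (q.2, q.1.2)) (p, s)) =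
      (Ioi p.1).indicator fun s => f (s, p.2) := by
    intro p
    ext s
    by_cases hs : p.1 < s
    · rw [indicator_of_mem (show (p, s) ∈ T from hs), indicator_of_mem (show s ∈ Ioi p.1 from hs)]
    · rw [indicator_of_notMem (show (p, s) ∉ T from hs),
        indicator_of_notMem (show s ∉ Ioi p.1 from hs)]
  have := LogConcave.marginal (g := T.indicator fun q : (ℝ × V) × ℝ => f (q.2, q.1.2))
    (by simpa using! h) (fun p => by rw [heq]; exact (hi p.2).indicator measurableSet_Ioi)
    (M := M) (fun p => (indicator_le_self' (fun _ _ => hf.nonneg _) p).trans (hM _))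
  simpa only [heq, integral_indicator measurableSet_Ioi] using this

theorem integrable_mul_log_fiber (hf : LogConcave f) (hint : Integrable f (volume.prod μ))
    (hi : ∀ y, Integrable fun s => f (s, y)) (hG : LogConcave fun y => ∫ s, f (s, y))
    (h0 : 0 < ∫ s, f (s, 0)) {M : ℝ} (hM : ∀ y, ∫ s, f (s, y) ≤ M) :
    Integrable (fun p => f p * Real.log ((∫ s, f (s, 0)) / ∫ s, f (s, p.2))) (volume.prod μ) ∧
    ∫ p, f p * Real.log ((∫ s, f (s, 0)) / ∫ s, f (s, p.2)) ∂(volume.prod μ) ≤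
      Module.finrank ℝ V * ∫ p, f p ∂(volume.prod μ) := by
  set G := fun y => ∫ s, f (s, y)
  have hGint : Integrable G μ := hint.integral_prod_right
  have hJ := hG.integrable_mul_log hGint h0 hM
  have hm : AEMeasurable (fun p : ℝ × V => G p.2) (volume.prod μ) :=
    (hG.aemeasurable (μ := μ)).comp_quasiMeasurePreserving Measure.quasiMeasurePreserving_snd
  have hlm : AEMeasurable (fun p => f p * Real.log (G 0 / G p.2)) (volume.prod μ) :=
    hint.aemeasurable.mul (hm.const_div _).log
  have hprod : Integrable (fun p => f p * Real.log (G 0 / G p.2)) (volume.prod μ) := by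
    rw [integrable_prod_iff' hlm.aestronglyMeasurable]
    refine ⟨Eventually.of_forall fun y => (hi y).mul_const (Real.log (G 0 / G y)), ?_⟩
    refine hJ.norm.congr (Eventually.of_forall fun y => ?_)
    simp only [norm_mul]
    rw [integral_mul_const, Real.norm_of_nonneg (hG.nonneg y)]
    congr 1
    exact integral_congr_ae (Eventually.of_forall fun s => (Real.norm_of_nonneg (hf.nonneg _)).symm)
  refine ⟨hprod, ?_⟩
  have h1 := hG.integral_mul_log_le hGint h0 hM
  rw [integral_prod_symm _ hprod, integral_prod_symm _ hint]
  simpa only [integral_mul_const] using h1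

theorem integrable_mul_log_tail (hf : LogConcave f) (hint : Integrable f (volume.prod μ))
    (hi : ∀ y, Integrable fun s => f (s, y)) (hG : LogConcave fun y => ∫ s, f (s, y))
    (hF : LogConcave fun p : ℝ × V => ∫ s in Ioi p.1, f (s, p.2)) :
    Integrable (fun p => f p * Real.log ((∫ s, f (s, p.2)) / ∫ s in Ioi p.1, f (s, p.2)))
      (volume.prod μ) ∧
    ∫ p, f p * Real.log ((∫ s, f (s, p.2)) / ∫ s in Ioi p.1, f (s, p.2)) ∂(volume.prod μ) ≤
      ∫ p, f p ∂(volume.prod μ) := by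
  set G := fun y => ∫ s, f (s, y)
  set F := fun p : ℝ × V => ∫ s in Ioi p.1, f (s, p.2)
  have hGint : Integrable G μ := hint.integral_prod_right
  have hm : AEMeasurable (fun p : ℝ × V => G p.2) (volume.prod μ) :=
    (hG.aemeasurable (μ := μ)).comp_quasiMeasurePreserving Measure.quasiMeasurePreserving_snd
  have hlm : AEMeasurable (fun p => f p * Real.log (G p.2 / F p)) (volume.prod μ) :=
    hint.aemeasurable.mul (hm.div hF.aemeasurable).log
  have hlog0 : ∀ p, 0 ≤ Real.log (G p.2 / F p) := fun p => by
    rcases (hF.nonneg p).eq_or_lt with h | h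
    · simp [F, ← h]
    · exact Real.log_nonneg ((one_le_div h).2
        (setIntegral_le_integral (hi p.2) (Eventually.of_forall fun s => hf.nonneg _)))
  have h0 : ∀ p, 0 ≤ f p * Real.log (G p.2 / F p) := fun p => mul_nonneg (hf.nonneg p) (hlog0 p)
  have hle : ∫⁻ p, ENNReal.ofReal (f p * Real.log (G p.2 / F p)) ∂(volume.prod μ) ≤
      ENNReal.ofReal (∫ p, f p ∂(volume.prod μ)) := by
    rw [lintegral_prod_symm _ hlm.ennreal_ofReal,
      integral_prod_symm _ hint, ofReal_integral_eq_lintegral_ofReal hGint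
        (Eventually.of_forall hG.nonneg)]
    refine lintegral_mono fun y => ?_
    simp only [ENNReal.ofReal_mul (hf.nonneg _)]
    exact lintegral_mul_log_div_setIntegral_Ioi_le (fun s => hf.nonneg (s, y)) (hi y)
  have hI : Integrable (fun p => f p * Real.log (G p.2 / F p)) (volume.prod μ) :=
    ⟨hlm.aestronglyMeasurable, by
      rw [hasFiniteIntegral_iff_ofReal (Eventually.of_forall h0)]
      exact hle.trans_lt ENNReal.ofReal_lt_top⟩
  refine ⟨hI, ?_⟩
  rwa [← ofReal_integral_eq_lintegral_ofReal hI (Eventually.of_forall h0),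
    ENNReal.ofReal_le_ofReal_iff (integral_nonneg hf.nonneg)] at hle

/-- Off the null frontier of the convex set `{f > 0}`, a point of that set is interior, so `f` stays
positive a little further along the line. Hence `log F` is a genuine logarithm `f`-almost
everywhere. -/
theorem ae_setIntegral_Ioi_pos (hf : LogConcave f) (hi : ∀ y, Integrable fun s => f (s, y)) :
    ∀ᵐ p ∂(volume.prod μ), 0 < f p → 0 < ∫ s in Ioi p.1, f (s, p.2) := by
  have h := (hf.convex_lt 0).addHaar_frontier (volume.prod μ)
  have h' : ∀ᵐ p ∂(volume.prod μ), p ∉ frontier {p | 0 < f p} := by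
    rw [ae_iff]
    simpa using h
  filter_upwards [h'] with p hp hfp
  have hmem : p ∈ interior {p | 0 < f p} := by
    by_contra hn
    exact hp ⟨subset_closure hfp, hn⟩
  have hcont : Tendsto (fun s : ℝ => (p.1 + s, p.2)) (𝓝[>] 0) (𝓝 p) := by
    have : Continuous fun s : ℝ => (p.1 + s, p.2) := by fun_prop
    exact (this.tendsto' 0 p (by simp)).mono_left nhdsWithin_le_nhds
  obtain ⟨s, hs, hs0⟩ := ((hcont.eventually (mem_interior_iff_mem_nhds.1 hmem)).and
    self_mem_nhdsWithin).exists
  have hs0' : (0 : ℝ) < s := hs0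
  exact (hf.comp_prodMk_right p.2).pos_of_mem_Icc (hi p.2) (t := p.1 + s) (by linarith) hfp hs

/-- Grünbaum's inequality for log-concave functions on `ℝ × V`, along the line `ℝ × {0}`. -/
theorem grunbaum_prod (hf : LogConcave f) (hint : Integrable f (volume.prod μ))
    (hpos : 0 < ∫ p, f p ∂(volume.prod μ)) (hcen : ∫ p, f p • p ∂(volume.prod μ) = 0) :
    Integrable (fun s => f (s, 0)) ∧
    Real.exp (-((Module.finrank ℝ V : ℝ) + 1)) * ∫ s, f (s, 0) ≤ ∫ s in Ioi 0, f (s, 0) := by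
  obtain ⟨C, hC, a, ha, hle⟩ := hf.exists_le_exp hint hpos
  have hfib := integrable_prodMk_right_of_le_exp hf hC ha hle
  have hi : ∀ y, Integrable fun s => f (s, y) := fun y => (hfib y).1
  refine ⟨hi 0, ?_⟩
  have hfM : ∀ p, f p ≤ C := fun p => (hle p).trans (by
    have : Real.exp (-a * ‖p‖) ≤ 1 := Real.exp_le_one_iff.2 (by
      have := norm_nonneg p
      nlinarith)
    nlinarith)
  have hG := hf.integral_fst hi hfM
  have hF := hf.setIntegral_Ioi_fst hi hfM
  rcases (hG.nonneg 0).eq_or_lt with h0 | h0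
  · rw [← h0, mul_zero]
    exact hF.nonneg (0, 0)
  obtain ⟨hA, hA'⟩ := integrable_mul_log_fiber hf hint hi hG h0 (fun y => (hfib y).2)
  obtain ⟨hB, hB'⟩ := integrable_mul_log_tail hf hint hi hG hF
  have hae := ae_setIntegral_Ioi_pos (μ := μ) hf hi
  set G := fun y => ∫ s, f (s, y)
  set F := fun p : ℝ × V => ∫ s in Ioi p.1, f (s, p.2)
  set I := ∫ p, f p ∂(volume.prod μ)
  have hFG : ∀ p, F p ≤ G p.2 := fun p =>
    setIntegral_le_integral (hi p.2) (Eventually.of_forall fun s => hf.nonneg _)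
  have heq : (fun p => Real.log (G 0) * f p - f p * Real.log (G 0 / G p.2) -
      f p * Real.log (G p.2 / F p)) =ᵐ[volume.prod μ] fun p => f p * Real.log (F p) := by
    filter_upwards [hae] with p hp
    rcases (hf.nonneg p).eq_or_lt with h | h
    · simp [← h]
    have h1 : 0 < F p := hp h
    have h2 : 0 < G p.2 := h1.trans_le (hFG p)
    rw [Real.log_div h0.ne' h2.ne', Real.log_div h2.ne' h1.ne']
    ring
  have hsub : Integrable (fun p => Real.log (G 0) * f p - f p * Real.log (G 0 / G p.2))
    (volume.prod μ) := (hint.const_mul (Real.log (G 0))).sub hA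
  have hlog : Integrable (fun p => f p * Real.log (F p)) (volume.prod μ) := (hsub.sub hB).congr heq
  have hge : (Real.log (G 0) - (Module.finrank ℝ V + 1)) * I ≤
      ∫ p, f p * Real.log (F p) ∂(volume.prod μ) := by
    rw [← integral_congr_ae heq, integral_sub hsub hB,
      integral_sub (hint.const_mul _) hA, integral_const_mul]
    linarith
  by_contra! hcon
  -- An intermediate `c` is positive even if `F (0, 0) = 0`, so Jensen's inequality at level `c`
  -- involves no default logarithm.
  obtain ⟨c, hc, hc'⟩ := exists_between hcon
  have hc0 : 0 < c := (hF.nonneg (0, 0)).trans_lt hc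
  have hJ := hF.integral_mul_log_le_of_centered hf.nonneg hint hpos
    (hf.integrable_smul_self hint hpos) hcen hae hlog hc.le
  have h3 := le_of_mul_le_mul_right (hge.trans hJ) hpos
  have h4 := Real.log_lt_log hc0 hc'
  rw [Real.log_mul (Real.exp_pos _).ne' h0.ne', Real.log_exp] at h4
  linarith

end Prod

/-! ### Passage to an arbitrary line -/

/-- Grünbaum's inequality for log-concave functions along a line through the center of mass. -/
theorem LogConcave.grunbaum {E : Type*} [NormedAddCommGroup E] [InnerProductSpace ℝ E]
    [MeasurableSpace E] [BorelSpace E] [FiniteDimensional ℝ E] {μ : Measure E}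
    [μ.IsAddHaarMeasure] {f : E → ℝ} (hf : LogConcave f) (hint : Integrable f μ)
    (hpos : 0 < ∫ x, f x ∂μ) (hcen : ∫ x, f x • x ∂μ = 0) {θ : E} (hθ : θ ≠ 0) :
    Integrable (fun s : ℝ => f (s • θ)) ∧
    Real.exp (-(Module.finrank ℝ E : ℝ)) * ∫ s : ℝ, f (s • θ) ≤
      ∫ s in Ioi (0 : ℝ), f (s • θ) := by
  set V := (ℝ ∙ θ)ᗮ
  have hdim : 1 + Module.finrank ℝ V = Module.finrank ℝ E := by
    rw [← finrank_span_singleton (K := ℝ) hθ]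
    exact Submodule.finrank_add_finrank_orthogonal _
  set L₀ : ℝ × V →ₗ[ℝ] E := (LinearMap.toSpanSingleton ℝ E θ).coprod V.subtype
  have hL₀ : ∀ p, L₀ p = p.1 • θ + p.2 := fun p => rfl
  have hinj : Function.Injective L₀ := by
    rw [injective_iff_map_eq_zero]
    rintro ⟨s, v⟩ h
    rw [hL₀] at h
    have h1 : inner ℝ θ (v : E) = 0 := Submodule.mem_orthogonal_singleton_iff_inner_right.1 v.2
    have h2 := congrArg (inner ℝ θ) h
    rw [inner_add_right, h1, inner_smul_right, inner_zero_right, add_zero, mul_eq_zero,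
      inner_self_eq_zero] at h2
    have hs : s = 0 := h2.resolve_right hθ
    simp only [hs, zero_smul, zero_add] at h
    ext
    · exact hs
    · simpa using h
  set L := (L₀.linearEquivOfInjective hinj (by
    rw [Module.finrank_prod, Module.finrank_self, hdim])).toContinuousLinearEquiv
  have hL : ∀ p, L p = p.1 • θ + p.2 := fun p => rfl
  set ρ := (volume : Measure ℝ).prod (Measure.addHaar : Measure V)
  have hLemb : MeasurableEmbedding L := L.toHomeomorph.measurableEmbedding
  have : (ρ.map L).IsAddHaarMeasure := L.isAddHaarMeasure_map ρ
  -- By uniqueness of Haar measure the transported product measure is a multiple of `μ`. The factor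
  -- is harmless, since no hypothesis depends on the scale of the measure.
  obtain ⟨c, hc, hmap⟩ : ∃ c : NNReal, 0 < c ∧ ρ.map L = c • μ :=
    ⟨_, Measure.addHaarScalarFactor_pos_of_isAddHaarMeasure _ _,
      Measure.isAddLeftInvariant_eq_smul (ρ.map L) μ⟩
  have h1 : Integrable (fun p => f (L p)) ρ := by
    refine hLemb.integrable_map_iff.1 ?_
    rw [hmap]
    exact hint.smul_measure_nnreal
  have h2 : 0 < ∫ p, f (L p) ∂ρ := by
    rw [← hLemb.integral_map, hmap, integral_smul_nnreal_measure]
    exact smul_pos hc hpos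
  have h3 : ∫ p, f (L p) • p ∂ρ = 0 := by
    apply L.injective
    rw [← L.integral_comp_comm, map_zero]
    simp only [map_smul]
    rw [← hLemb.integral_map (fun x => f x • x), hmap, integral_smul_nnreal_measure, hcen,
      smul_zero]
  have h4 : LogConcave fun p => f (L p) := by
    simpa using hf.comp_affine L.toLinearEquiv.toLinearMap 0
  have key := grunbaum_prod h4 h1 h2 h3
  simp only [hL, Submodule.coe_zero, add_zero] at key
  rwa [← hdim, Nat.cast_add, Nat.cast_one, add_comm (1 : ℝ)]

/-! ### The extremal function on the cone -/

theorem LogConcave.const_mul {E : Type*} [AddCommGroup E] [Module ℝ E] {f : E → ℝ}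
    (hf : LogConcave f) {c : ℝ} (hc : 0 < c) : LogConcave fun x => c * f x := by
  refine ⟨fun x => mul_nonneg hc.le (hf.nonneg x), fun x y a b ha hb hab => ?_⟩
  rw [Real.mul_rpow hc.le (hf.nonneg x), Real.mul_rpow hc.le (hf.nonneg y), mul_mul_mul_comm,
    ← Real.rpow_add hc, hab, Real.rpow_one]
  exact mul_le_mul_of_nonneg_left (hf.rpow_mul_rpow_le x y a b ha hb hab) hc.le

/-- Ratios on both sides of `1` are allowed, so `l = 1` is a local minimum of the difference and its
derivative vanishes there. -/
theorem eq_mul_of_inv_pow_bound {m : ℕ} {I J : ℝ}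
    (h : ∀ l : ℝ, 0 < l → (1 - l) * J ≤ (l ^ m)⁻¹ * I - I) : J = m * I := by
  have hd : HasDerivAt (fun l : ℝ => (l ^ m)⁻¹ * I - (1 - l) * J) (-(m * I) + J) 1 := by
    have h1 := ((hasDerivAt_pow m (1 : ℝ)).inv (by simp)).mul_const I
    have h2 := ((hasDerivAt_id (1 : ℝ)).const_sub 1).mul_const J
    convert! h1.sub h2 using 1
    simp
  have hmin : IsLocalMin (fun l : ℝ => (l ^ m)⁻¹ * I - (1 - l) * J) 1 := by
    filter_upwards [lt_mem_nhds (zero_lt_one' ℝ)] with l hl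
    have := h l hl
    simp only [one_pow, inv_one, one_mul, sub_self, zero_mul, sub_zero]
    linarith
  have := hmin.hasDerivAt_eq_zero hd
  linarith

section Cone

variable {n : ℕ} [NeZero n]

local notation "𝐞" => (EuclideanSpace.single (0 : Fin n) (1 : ℝ))

theorem norm_sub_smul_single_sq (x : EuclideanSpace ℝ (Fin n)) :
    ‖x - x 0 • 𝐞‖ ^ 2 = ∑ i ∈ Finset.univ.erase 0, x i ^ 2 := by
  rw [EuclideanSpace.norm_sq_eq, ← Finset.add_sum_erase _ _ (Finset.mem_univ (0 : Fin n))]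
  simp only [PiLp.sub_apply, PiLp.smul_apply, PiLp.single_apply, Real.norm_eq_abs,
    sq_abs]
  simp only [if_true, smul_eq_mul, mul_one, sub_self, ne_eq, OfNat.ofNat_ne_zero, not_false_eq_true,
    zero_pow, zero_add]
  refine Finset.sum_congr rfl fun i hi => ?_
  rw [if_neg (Finset.ne_of_mem_erase hi)]
  simp

theorem mem_grunbaumCone_iff (x : EuclideanSpace ℝ (Fin n)) :
    x ∈ grunbaumCone n ↔ ‖x - x 0 • 𝐞‖ ≤ x 0 + n := by
  rw [grunbaumCone, mem_ofPred_eq, ← norm_sub_smul_single_sq]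
  constructor
  · rintro ⟨h1, h2⟩
    exact (pow_le_pow_iff_left₀ (norm_nonneg _) (by linarith) two_ne_zero).1 h2
  · intro h
    have := (norm_nonneg _).trans h
    exact ⟨by linarith, by gcongr⟩

/-- The infinite circular cone with vertex at the origin, axis along the first coordinate. -/
def circularCone (n : ℕ) [NeZero n] : Set (EuclideanSpace ℝ (Fin n)) :=
  {x | ‖x - x 0 • EuclideanSpace.single 0 1‖ ≤ x 0}

/-- The function `exp (-x₁)` on the cone with vertex at the origin. -/
noncomputable def circularConeExp (n : ℕ) [NeZero n] : EuclideanSpace ℝ (Fin n) → ℝ :=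
  (circularCone n).indicator fun x => Real.exp (-(x 0))

/-- Moving the vertex to the origin makes the cone invariant under positive dilations, so its
moments follow from scaling. -/
theorem coneExp_eq (x : EuclideanSpace ℝ (Fin n)) :
    coneExp n x = Real.exp n * circularConeExp n (x + (n : ℝ) • 𝐞) := by
  have h0 : (x + (n : ℝ) • 𝐞) 0 = x 0 + n := by simp
  have h1 : x + (n : ℝ) • 𝐞 ∈ circularCone n ↔ x ∈ grunbaumCone n := by
    rw [mem_grunbaumCone_iff, circularCone, mem_ofPred_eq, h0, add_smul, add_sub_add_right_eq_sub]
  by_cases hx : x ∈ grunbaumCone n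
  · rw [coneExp, circularConeExp, indicator_of_mem hx, indicator_of_mem (h1.2 hx), h0,
      ← Real.exp_add]
    ring_nf
  · rw [coneExp, circularConeExp, indicator_of_notMem hx, indicator_of_notMem (mt h1.1 hx),
      mul_zero]

theorem nonneg_of_mem_circularCone {x : EuclideanSpace ℝ (Fin n)} (hx : x ∈ circularCone n) :
    0 ≤ x 0 := (norm_nonneg _).trans hx

theorem convex_circularCone : Convex ℝ (circularCone n) := by
  intro x hx y hy a b ha hb _
  have h1 : ‖x - x 0 • 𝐞‖ ≤ x 0 := hx
  have h2 : ‖y - y 0 • 𝐞‖ ≤ y 0 := hy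
  show ‖a • x + b • y - (a * x 0 + b * y 0) • 𝐞‖ ≤ a * x 0 + b * y 0
  have : a • x + b • y - (a * x 0 + b * y 0) • 𝐞 =
      a • (x - x 0 • 𝐞) + b • (y - y 0 • 𝐞) := by
    module
  rw [this]
  refine (norm_add_le _ _).trans ?_
  rw [norm_smul, norm_smul, Real.norm_of_nonneg ha, Real.norm_of_nonneg hb]
  gcongr

theorem smul_mem_circularCone_iff {l : ℝ} (hl : 0 < l) (x : EuclideanSpace ℝ (Fin n)) :
    l • x ∈ circularCone n ↔ x ∈ circularCone n := by
  have : l • x - (l • x) 0 • 𝐞 = l • (x - x 0 • 𝐞) := by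
    rw [PiLp.smul_apply, smul_eq_mul]; module
  rw [circularCone, mem_ofPred_eq, mem_ofPred_eq, this, norm_smul, Real.norm_of_nonneg hl.le,
    PiLp.smul_apply, smul_eq_mul, mul_le_mul_iff_right₀ hl]

theorem logConcave_circularConeExp : LogConcave (circularConeExp n) := by
  refine LogConcave.indicator ⟨fun x => (Real.exp_pos _).le, fun x y a b _ _ _ => ?_⟩
    convex_circularCone
  rw [← Real.exp_mul, ← Real.exp_mul, ← Real.exp_add]
  refine le_of_eq (congrArg _ ?_)
  simp only [PiLp.add_apply, PiLp.smul_apply, smul_eq_mul]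
  ring

theorem integrable_circularConeExp : Integrable (circularConeExp n) := by
  -- The rate `1 / 2` comes from `‖x‖ ≤ 2 x₁` on the cone.
  refine (integrable_exp_neg_mul_norm (E := EuclideanSpace ℝ (Fin n)) (half_pos one_pos)).mono'
    logConcave_circularConeExp.aemeasurable.aestronglyMeasurable (Eventually.of_forall fun x => ?_)
  rw [Real.norm_of_nonneg (logConcave_circularConeExp.nonneg x)]
  by_cases hx : x ∈ circularCone n
  · rw [circularConeExp, indicator_of_mem hx]
    have h0 := nonneg_of_mem_circularCone hx
    have h1 : ‖x‖ ≤ ‖x - x 0 • 𝐞‖ + ‖x 0 • 𝐞‖ := by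
      simpa using norm_add_le (x - x 0 • 𝐞) (x 0 • 𝐞)
    have h2 : ‖x 0 • 𝐞‖ = x 0 := by
      rw [norm_smul, PiLp.norm_single, norm_one, mul_one, Real.norm_of_nonneg h0]
    have h3 : ‖x - x 0 • 𝐞‖ ≤ x 0 := hx
    apply Real.exp_le_exp.2
    linarith
  · rw [circularConeExp, indicator_of_notMem hx]
    positivity

theorem integral_circularConeExp_pos : 0 < ∫ x, circularConeExp n x := by
  rw [integral_pos_iff_support_of_nonneg logConcave_circularConeExp.nonneg
    integrable_circularConeExp]
  have hopen : IsOpen {x : EuclideanSpace ℝ (Fin n) | ‖x - x 0 • 𝐞‖ < x 0} :=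
    isOpen_lt (by fun_prop) (by fun_prop)
  refine (hopen.measure_pos volume ⟨𝐞, by simp⟩).trans_le (measure_mono fun x hx => ?_)
  have hlt : ‖x - x 0 • 𝐞‖ < x 0 := hx
  have hx' : x ∈ circularCone n := hlt.le
  rw [Function.mem_support, circularConeExp, indicator_of_mem hx']
  exact (Real.exp_pos _).ne'

theorem integrable_circularConeExp_smul : Integrable fun x => circularConeExp n x • x :=
  logConcave_circularConeExp.integrable_smul_self integrable_circularConeExp
    integral_circularConeExp_pos

/-- On the cone, `h(lx) = h(x) e^{(1-l)x₁} ≥ h(x) (1 + (1-l)x₁)` for every `l > 0`. Integrating and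
differentiating at `l = 1` gives equality. -/
theorem integral_circularConeExp_mul_zero :
    ∫ x, circularConeExp n x * x 0 = n * ∫ x, circularConeExp n x := by
  refine eq_mul_of_inv_pow_bound fun l hl => ?_
  have hi := integrable_circularConeExp (n := n)
  have hs := hi.comp_smul hl.ne'
  have hx : Integrable fun x => circularConeExp n x * x 0 := by
    simpa using (EuclideanSpace.proj (0 : Fin n) : _ →L[ℝ] ℝ).integrable_comp
      (integrable_circularConeExp_smul (n := n))
  have hle : ∀ x, (1 - l) * (circularConeExp n x * x 0) ≤
      circularConeExp n (l • x) - circularConeExp n x := by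
    intro x
    by_cases h : x ∈ circularCone n
    · rw [circularConeExp, indicator_of_mem h,
        indicator_of_mem ((smul_mem_circularCone_iff hl x).2 h)]
      have h1 : Real.exp (-(l • x) 0) = Real.exp (-(x 0)) * Real.exp ((1 - l) * x 0) := by
        rw [← Real.exp_add, PiLp.smul_apply, smul_eq_mul]; ring_nf
      have h2 := mul_le_mul_of_nonneg_left (Real.add_one_le_exp ((1 - l) * x 0))
        (Real.exp_pos (-(x 0))).le
      rw [h1]
      linarith
    · rw [circularConeExp, indicator_of_notMem h,
        indicator_of_notMem (mt (smul_mem_circularCone_iff hl x).1 h)]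
      simp
  have := integral_mono (hx.const_mul (1 - l)) (hs.sub hi) hle
  simp only [Pi.sub_apply] at this
  rwa [integral_const_mul, integral_sub hs hi, Measure.integral_comp_smul_of_nonneg _ _ _
    (hR := hl.le), smul_eq_mul, finrank_euclideanSpace_fin] at this

theorem integral_circularConeExp_smul :
    ∫ x, circularConeExp n x • x = (n * ∫ x, circularConeExp n x) • 𝐞 := by
  -- Reflection in the axis fixes the function and negates the other coordinates, so their moments
  -- vanish.
  set R := (ℝ ∙ 𝐞).reflection
  have hR : ∀ x, R x = (2 * x 0) • 𝐞 - x := by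
    intro x
    rw [Submodule.reflection_singleton_apply]
    simp [EuclideanSpace.inner_single_left, mul_smul, ofNat_smul_eq_nsmul]
  have hR0 : ∀ x, R x 0 = x 0 := fun x => by
    rw [hR]; simp; ring
  have hRi : ∀ x, ∀ i ≠ 0, R x i = -x i := fun x i hi => by
    rw [hR]; simp [hi]
  have hinv : ∀ x, circularConeExp n (R x) = circularConeExp n x := by
    intro x
    have h1 : ‖R x - R x 0 • 𝐞‖ = ‖x - x 0 • 𝐞‖ := by
      rw [hR0, hR, ← norm_neg]
      congr 1
      module
    have h2 : R x ∈ circularCone n ↔ x ∈ circularCone n := by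
      rw [circularCone, mem_ofPred_eq, mem_ofPred_eq, h1, hR0]
    by_cases h : x ∈ circularCone n
    · rw [circularConeExp, indicator_of_mem h, indicator_of_mem (h2.2 h), hR0]
    · rw [circularConeExp, indicator_of_notMem h, indicator_of_notMem (mt h2.1 h)]
  set v := ∫ x, circularConeExp n x • x
  have hv : R v = v := by
    have h1 : R v = ∫ x, R (circularConeExp n x • x) :=
      (R.toContinuousLinearEquiv.integral_comp_comm _).symm
    rw [h1]
    have h2 := R.measurePreserving.integral_comp R.toHomeomorph.measurableEmbedding
      (fun x => circularConeExp n x • x)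
    simpa only [map_smul, hinv] using h2
  ext i
  rcases eq_or_ne i 0 with rfl | hi
  · have h := (EuclideanSpace.proj (0 : Fin n) : _ →L[ℝ] ℝ).integral_comp_comm
      (integrable_circularConeExp_smul (n := n))
    simp only [map_smul, PiLp.proj_apply, smul_eq_mul] at h
    rw [← h, integral_circularConeExp_mul_zero]
    simp
  · have h := hRi v i hi
    rw [hv] at h
    have : v i = 0 := by linarith
    simp [this, hi]

theorem centeredLogConcave_coneExp : CenteredLogConcave (coneExp n) := by
  have heq : coneExp n = fun x => Real.exp n * circularConeExp n (x + (n : ℝ) • 𝐞) :=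
    funext coneExp_eq
  have hi := integrable_circularConeExp (n := n)
  refine ⟨?_, ?_, ?_, ?_⟩
  · rw [heq]
    exact (logConcave_circularConeExp.comp_affine LinearMap.id _).const_mul (Real.exp_pos _)
  · rw [heq]
    exact (hi.comp_add_right _).const_mul _
  · rw [heq, integral_const_mul, integral_add_right_eq_self]
    exact mul_pos (Real.exp_pos _) integral_circularConeExp_pos
  · have h1 : ∀ x, coneExp n x • x = (fun y => Real.exp n • (circularConeExp n y • y -
        circularConeExp n y • (n : ℝ) • 𝐞)) (x + (n : ℝ) • 𝐞) := by
      intro x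
      simp only [coneExp_eq]
      module
    simp only [h1]
    rw [integral_add_right_eq_self (fun y => Real.exp n • (circularConeExp n y • y -
        circularConeExp n y • (n : ℝ) • 𝐞)), integral_smul, integral_sub
        integrable_circularConeExp_smul (hi.smul_const _), integral_circularConeExp_smul,
        integral_smul_const]
    module

theorem coneExp_smul_single (s : ℝ) :
    coneExp n (s • 𝐞) = (Ici (-(n : ℝ))).indicator (fun s => Real.exp (-s)) s := by
  have h0 : (s • 𝐞) 0 = s := by simp
  have h1 : s • 𝐞 ∈ grunbaumCone n ↔ s ∈ Ici (-(n : ℝ)) := by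
    rw [mem_grunbaumCone_iff, h0, sub_self, norm_zero, mem_Ici, neg_le_iff_add_nonneg]
  by_cases h : s ∈ Ici (-(n : ℝ))
  · rw [coneExp, indicator_of_mem h, indicator_of_mem (h1.2 h), h0]
  · rw [coneExp, indicator_of_notMem h, indicator_of_notMem (mt h1.1 h)]

theorem integral_coneExp_smul_single : ∫ s : ℝ, coneExp n (s • 𝐞) = Real.exp n := by
  simp only [coneExp_smul_single]
  rw [integral_indicator measurableSet_Ici, integral_Ici_eq_integral_Ioi, integral_exp_neg_Ioi,
    neg_neg]

theorem setIntegral_coneExp_smul_single : ∫ s in Ioi (0 : ℝ), coneExp n (s • 𝐞) = 1 := by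
  rw [setIntegral_congr_fun measurableSet_Ioi (g := fun s => Real.exp (-s)), integral_exp_neg_Ioi,
    neg_zero, Real.exp_zero]
  intro s hs
  have hs' : (0 : ℝ) < s := hs
  have hn : (0 : ℝ) ≤ n := n.cast_nonneg
  simp only [coneExp_smul_single]
  exact indicator_of_mem (show -(n : ℝ) ≤ s by linarith) _

end Cone

/-! ### The theorem -/

theorem mainTheorem1 (n : ℕ) [NeZero n] :
    -- the inequality
    (∀ f : EuclideanSpace ℝ (Fin n) → ℝ, CenteredLogConcave f →
      ∀ θ : EuclideanSpace ℝ (Fin n), ‖θ‖ = 1 →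
        Integrable (fun s : ℝ => f (s • θ)) ∧
        Real.exp (-(n : ℝ)) * ∫ s : ℝ, f (s • θ) ≤ ∫ s in Set.Ioi (0 : ℝ), f (s • θ)) ∧
    -- the constant is the best possible
    IsGreatest
      {a : ℝ | ∀ f : EuclideanSpace ℝ (Fin n) → ℝ, CenteredLogConcave f →
        ∀ θ : EuclideanSpace ℝ (Fin n), ‖θ‖ = 1 →
          a * ∫ s : ℝ, f (s • θ) ≤ ∫ s in Set.Ioi (0 : ℝ), f (s • θ)}
      (Real.exp (-(n : ℝ))) ∧
    -- the truncated exponential on the cone is admissible and attains equality along `e₁`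
    (CenteredLogConcave (coneExp n) ∧
      Integrable (fun x : EuclideanSpace ℝ (Fin n) => coneExp n x • x) ∧
      ∫ s : ℝ, coneExp n (s • EuclideanSpace.single 0 1) = Real.exp n ∧
      ∫ s in Set.Ioi (0 : ℝ), coneExp n (s • EuclideanSpace.single 0 1) = 1 ∧
      ∫ s in Set.Ioi (0 : ℝ), coneExp n (s • EuclideanSpace.single 0 1) =
        Real.exp (-(n : ℝ)) * ∫ s : ℝ, coneExp n (s • EuclideanSpace.single 0 1)) := by
  have hineq : ∀ f : EuclideanSpace ℝ (Fin n) → ℝ, CenteredLogConcave f →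
      ∀ θ : EuclideanSpace ℝ (Fin n), ‖θ‖ = 1 →
        Integrable (fun s : ℝ => f (s • θ)) ∧
        Real.exp (-(n : ℝ)) * ∫ s : ℝ, f (s • θ) ≤ ∫ s in Set.Ioi (0 : ℝ), f (s • θ) := by
    intro f hf θ hθ
    have hθ0 : θ ≠ 0 := by
      rintro rfl
      simp at hθ
    simpa using hf.logConcave.grunbaum hf.integrable hf.mass_pos hf.center hθ0
  have hcone := centeredLogConcave_coneExp (n := n)
  refine ⟨hineq, ⟨fun f hf θ hθ => (hineq f hf θ hθ).2, fun a ha => ?_⟩, hcone,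
    hcone.logConcave.integrable_smul_self hcone.integrable hcone.mass_pos,
    integral_coneExp_smul_single, setIntegral_coneExp_smul_single, ?_⟩
  -- Testing an admissible constant `a` on the cone gives `a eⁿ ≤ 1`.
  · have h := ha _ hcone (EuclideanSpace.single 0 1) (by simp)
    rw [integral_coneExp_smul_single, setIntegral_coneExp_smul_single] at h
    rw [Real.exp_neg, ← one_div, le_div_iff₀ (Real.exp_pos _)]
    exact h
  · rw [integral_coneExp_smul_single, setIntegral_coneExp_smul_single, ← Real.exp_add]
    simp
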